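/- **Link diagrams.** An unoriented link diagram in the plane, in general position with respect to the vertical direction, is a finite sequence of slices read from bottom to top, beginning and ending with no strands. Each slice contains one event on neighbouring strands, all other strands being vertical: a creation of two strands (minimum, "cup"), an annihilation of two strands (maximum, "cap"), a crossing $X_+$ (the strand coming from the bottom left passes over) or a crossing $X_-$ (it passes under). *Regular isotopy* is the equivalence relation on link diagrams generated by Reidemeister moves II and III together with isotopy of the plane, that is: exchanging the heights of two events lying side by side, cancelling a minimum against an adjacent maximum of the same strand, and sliding a crossing through a maximum or minimum of one of its strands. **State sum.** Let $F$ be a field, $N\ge 1$, $\mathcal B=(\mathcal B_{ab}^{cd})$ an invertible $N^2\times N^2$ matrix (lower indices: row, incoming states; upper indices: column, outgoing states) and $\mathcal M=(\mathcal M_{ab})$ an invertible $N\times N$ matrix with inverse $\mathcal M^{-1}=(\mathcal M^{ab})$, $a,b,c,d\in\{0,\dots,N-1\}$. The vacuum expectation $\langle K\rangle\in F$ of a link diagram $K$ is the sum, over all labelings of the strands between consecutive slices by $\{0,\dots,N-1\}$ (constant along vertical strands), of the product of the amplitudes of the events: $\mathcal M^{ab}$ for a cup, $\mathcal M_{ab}$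 for a cap, $\mathcal B_{ab}^{cd}$ for $X_+$ and $(\mathcal B^{-1})_{ab}^{cd}$ for $X_-$. **Matrices.** Let $n\ge 1$, $0\ne q\in F$, and fix a fourth root $q^{1/4}\in F$ (so $q^{k/4}=(q^{1/4})^k$). For $N\ge1$, $0\ne\gamma\in F$ and elements $\beta(a,b)$ $(a<b)$ let $\mathcal B$ act on $v_a\otimes v_b\mapsto\sum_{c,d}\mathcal B_{ab}^{cd}v_c\otimes v_d$ as follows. If $a+b\ne N-1$: $$v_a\otimes v_a\mapsto\gamma\, v_a\otimes v_a;\qquad v_a\otimes v_b\mapsto v_b\otimes v_a\ (a>b);\qquad v_a\otimes v_b\mapsto v_b\otimes v_a+(\gamma-\gamma^{-1})v_a\otimes v_b\ (a<b).$$ If $a+b=N-1$: $$v_a\otimes v_{N-1-a}\mapsto \epsilon_a\, v_{N-1-a}\otimes v_a+\sum_{b>a}\beta(a,b)\,v_{N-1-b}\otimes v_b ,$$ with $\epsilon_a=1$ if $2a=N-1$ and $\epsilon_a=\gamma^{-1}$ otherwise. Further let $\mathcal M_{ab}=0$ unless $a+b=N-1$, and $\mathcal M_{a,N-1-a}=t\,\mu_a$,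 where $t\in F\setminus\{0\}$ is an arbitrary normalization constant. The braiding and fusion matrices of the fundamental (vector) representations are given by the following data. The states are ordered by weight; for $D_n$ the two middle weights are numbered $n-1$ and $n$. * $B_n$: $N=2n+1$, $\gamma=q^{-1/2}$, $z=q^{1/2}-q^{-1/2}$; $\mu_a=q^{\frac12(n-a-\frac12)}$ for $a<n$, $\mu_n=1$, $\mu_a=q^{\frac12(n-a+\frac12)}$ for $a>n$; $\beta(a,b)$ equals $z\,q^{-\frac12(a-b)}$ if $(a-n)(b-n)>0$, $z\,q^{-\frac12(a-b+\frac12)}$ if $(a-n)(b-n)=0$, and $z\,q^{-\frac12(a-b+1)}-z\,\delta_{a+b,2n}$ if $(a-n)(b-n)<0$. * $C_n$: $N=2n$, $\gamma=q^{-1/4}$, $z=q^{1/4}-q^{-1/4}$; $\mu_a=-I\,q^{\frac{n-a}4}$ for $a<n$ and $\mu_a=I\,q^{\frac{n-a-1}4}$ for $a\ge n$, where $I\in F$ and $I^2=-1$; $\beta(a,b)$ equals $z\,q^{-\frac14(a-b)}$ if $(a-n+\frac12)(b-n+\frac12)>0$ and $-z\,q^{-\frac14(a-b-1)}-z\,\delta_{a+b,2n-1}$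 otherwise. * $D_n$: $N=2n$, $\gamma=q^{-1/2}$, $z=q^{1/2}-q^{-1/2}$; $\mu_a=q^{\frac{n-a-1}2}$ for $a<n$ and $\mu_a=q^{\frac{n-a}2}$ for $a\ge n$; $\beta(a,b)$ equals $z\,q^{-\frac12(a-b)}$ if $(a-n+\frac12)(b-n+\frac12)>0$ and $z\,q^{-\frac12(a-b+1)}-z\,\delta_{a+b,2n-1}$ otherwise. **Theorem.** Let $\alpha=q^{n}$ for $B_n$, $\alpha=-q^{(2n+1)/4}$ for $C_n$, $\alpha=q^{(2n-1)/2}$ for $D_n$, and assume $z\neq0$ (that is, $q\ne1$ for $B_n$ and $D_n$, and $q^{1/2}\neq1$ for $C_n$). In each of the three cases $\mathcal B$ and $\mathcal M$ are invertible, and the vacuum expectation $D_K=\langle K\rangle$ satisfies the axioms of the Kauffman polynomial with parameters $z$ and $\alpha$: 1. if $K$ and $K'$ are regularly isotopic, then $D_K=D_{K'}$; 2. $D_{L_+}-D_{L_-}=z\,(D_{L_\infty}-D_{L_0})$ whenever $L_+,L_-,L_\infty,L_0$ agree except at one place, where they consist of $X_+$, of $X_-$, of a cap followed by a cup, and of two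 vertical strands, respectively; 3. $D_{\bigcirc}=\dfrac{\alpha-\alpha^{-1}}{z}+1$; and $D_{W_+}=\alpha D_W$, $D_{W_-}=\alpha^{-1}D_W$ whenever $W_\pm$ arises from $W$ by inserting $X_\pm$ on the two strands of a cap directly below it, or on the two strands of a cup directly above it. -/

import Mathlib

namespace LinkSum

/-! ### Link diagrams

An unoriented link diagram in the plane is put in general position with respect to the vertical
(time) direction and read from bottom to top as a sequence of elementary events on a row of
strands: the creation of two neighbouring strands (a minimum), the annihilation of two
neighbouring strands (a maximum), and the two kinds of crossing of two neighbouring strands. -/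

/-- The elementary events. `cross true` is the crossing with amplitude `𝓑`
(the strand that starts on the left passes over), `cross false` is the crossing with
amplitude `𝓑⁻¹` (the strand that starts on the left passes under). -/
inductive Kind where
  | cup : Kind
  | cap : Kind
  | cross : Bool → Kind

/-- Number of strands that enter an event from below. -/
def Kind.inputs : Kind → ℕ
  | .cup => 0
  | .cap => 2
  | .cross _ => 2

/-- Number of strands that leave an event at the top. -/
def Kind.outputs : Kind → ℕ
  | .cup => 2
  | .cap => 0
  | .cross _ => 2

/-- A slice of a diagram: one event, with `pos` vertical strands to the left of it
(and the remaining strands, also vertical, to the right of it). -/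
structure Slice where
  kind : Kind
  pos : ℕ

/-- The creation of two strands to the right of the first `i` strands. -/
def cup (i : ℕ) : Slice := ⟨.cup, i⟩

/-- The annihilation of the strands number `i` and `i + 1` (counted from `0`). -/
def cap (i : ℕ) : Slice := ⟨.cap, i⟩

/-- The crossing of the strands number `i` and `i + 1` (counted from `0`). -/
def cross (e : Bool) (i : ℕ) : Slice := ⟨.cross e, i⟩

/-- `IsTangle m w n`: the slices `w`, stacked from bottom to top, fit together to a
diagram with `m` end points at the bottom and `n` end points at the top. -/
def IsTangle : ℕ → List Slice → ℕ → Prop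
  | m, [], n => m = n
  | m, p :: w, n => p.pos + p.kind.inputs ≤ m ∧ IsTangle (m - p.kind.inputs + p.kind.outputs) w n

/-- A link diagram: a diagram that starts from and ends in the vacuum (no strands). -/
structure LinkDiagram where
  word : List Slice
  closed : IsTangle 0 word 0

/-- The round circle without crossings. -/
def circle : LinkDiagram := ⟨[cup 0, cap 0], by simp [IsTangle, cup, cap, Kind.inputs, Kind.outputs]⟩

/-! ### Regular isotopy -/

/-- The local changes of a diagram in general position with respect to the vertical direction
under an isotopy of the plane. -/
inductive PlanarMove : List Slice → List Slice → Prop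
  /-- Two events that happen side by side may exchange their heights; `k` is the number of
  strands between them. -/
  | exchange (p q : Kind) (i k : ℕ) :
      PlanarMove [⟨p, i⟩, ⟨q, i + p.outputs + k⟩] [⟨q, i + p.inputs + k⟩, ⟨p, i⟩]
  /-- A minimum and a neighbouring maximum of the same strand cancel. -/
  | zigzagRight (i : ℕ) : PlanarMove [cup i, cap (i + 1)] []
  | zigzagLeft (i : ℕ) : PlanarMove [cup (i + 1), cap i] []
  /-- A crossing slides through a maximum or a minimum of one of its two strands. -/
  | slideCap (e : Bool) (i : ℕ) : PlanarMove [cross e i, cap (i + 1)] [cross (!e) (i + 1), cap i]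
  | slideCup (e : Bool) (i : ℕ) : PlanarMove [cup i, cross e (i + 1)] [cup (i + 1), cross (!e) i]

/-- Reidemeister move II. -/
inductive ReidemeisterII : List Slice → List Slice → Prop
  | cancel (e : Bool) (i : ℕ) : ReidemeisterII [cross e i, cross (!e) i] []

/-- Reidemeister move III. The condition on the signs says that the three strands lie one above
the other (the two excluded sign patterns are those in which the first strand passes over
the second, the second over the third, and the third over the first, or the reverse). -/
inductive ReidemeisterIII : List Slice → List Slice → Prop
  | triangle (e₁ e₂ e₃ : Bool) (h : e₁ = e₂ ∨ e₂ = e₃) (i : ℕ) :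
      ReidemeisterIII [cross e₁ i, cross e₂ (i + 1), cross e₃ i]
        [cross e₃ (i + 1), cross e₂ i, cross e₁ (i + 1)]

/-- Two link diagrams differ by one local move. -/
def Step (K K' : LinkDiagram) : Prop :=
  ∃ u x y v : List Slice, (PlanarMove x y ∨ ReidemeisterII x y ∨ ReidemeisterIII x y) ∧
    K.word = u ++ x ++ v ∧ K'.word = u ++ y ++ v

/-- Regular isotopy: the equivalence relation on link diagrams (up to isotopy of the plane)
generated by the Reidemeister moves II and III. -/
def RegularIsotopic : LinkDiagram → LinkDiagram → Prop := Relation.EqvGen Step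

/-! ### The axioms of the Kauffman polynomial -/

/-- The axioms for the Kauffman polynomial (in its Dubrovnik form `D_K(z, α)`) of unoriented links,
with given values of the variables `z` and `α`. -/
structure IsKauffmanPolynomial {F : Type*} [Field F] (z α : F) (D : LinkDiagram → F) : Prop where
  regular_isotopy : ∀ K K' : LinkDiagram, RegularIsotopic K K' → D K = D K'
  /-- `L₊`, `L₋`, `L∞`, `L₀` agree except at one place, where they look like the two crossings,
  a maximum below a minimum, and two vertical strands. -/
  skein : ∀ (u v : List Slice) (i : ℕ) (Lp Lm Linf L0 : LinkDiagram),
    Lp.word = u ++ [cross true i] ++ v → Lm.word = u ++ [cross false i] ++ v →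
    Linf.word = u ++ [cap i, cup i] ++ v → L0.word = u ++ v →
    D Lp - D Lm = z * (D Linf - D L0)
  circle_eq : D circle = (α - α⁻¹) / z + 1
  /-- A curl at a maximum. -/
  curl_cap : ∀ (u v : List Slice) (i : ℕ) (Wp Wm W : LinkDiagram),
    Wp.word = u ++ [cross true i, cap i] ++ v → Wm.word = u ++ [cross false i, cap i] ++ v →
    W.word = u ++ [cap i] ++ v → D Wp = α * D W ∧ D Wm = α⁻¹ * D W
  /-- A curl at a minimum. -/
  curl_cup : ∀ (u v : List Slice) (i : ℕ) (Wp Wm W : LinkDiagram),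
    Wp.word = u ++ [cup i, cross true i] ++ v → Wm.word = u ++ [cup i, cross false i] ++ v →
    W.word = u ++ [cup i] ++ v → D Wp = α * D W ∧ D Wm = α⁻¹ * D W

/-! ### The state sum -/

section StateSum

variable {F ι : Type*} [Field F] [Fintype ι]

/-- The amplitude of the process `w` that starts from the row of states `st` and ends in the
vacuum: the sum over all internal configurations of the products of the amplitudes of the
events. The matrices are indexed with the lower indices (states before the event) as rows and the
upper indices (states after the event) as columns, `B (a, b) (c, d) = 𝓑_{ab}^{cd}`;
`M a b = 𝓜_{ab}` is the amplitude of an annihilation, `M' a b = 𝓜^{ab}` that of a creation. -/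
def amplitude (B B' : Matrix (ι × ι) (ι × ι) F) (M M' : Matrix ι ι F) :
    List Slice → List ι → F
  | [], [] => 1
  | [], _ :: _ => 0
  | p :: w, st =>
    match p.kind, st.drop p.pos with
    | .cup, r => ∑ a, ∑ b, M' a b * amplitude B B' M M' w (st.take p.pos ++ a :: b :: r)
    | .cap, a :: b :: r => M a b * amplitude B B' M M' w (st.take p.pos ++ r)
    | .cross e, a :: b :: r =>
        ∑ c, ∑ d, (bif e then B (a, b) (c, d) else B' (a, b) (c, d)) *
          amplitude B B' M M' w (st.take p.pos ++ c :: d :: r)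
    | _, _ => 0

/-- The vacuum expectation `⟨K⟩` built from the braiding matrix `B`, its inverse, the fusion
matrix `M` and its inverse. -/
noncomputable def vacuumExpectation [DecidableEq ι] (B : Matrix (ι × ι) (ι × ι) F)
    (M : Matrix ι ι F) (K : LinkDiagram) : F :=
  amplitude B B⁻¹ M M⁻¹ K.word []

end StateSum

/-! ### The braiding and fusion matrices

The states `v_0, …, v_{N-1}` are the weight vectors of the fundamental representation in their
order; `v_a` and `v_b` are complementary if `a + b = N - 1`. Here `N = 2n + 1` for `B_n` and
`N = 2n` for `C_n` and `D_n`; for `D_n` a state is named by its order `o(a)`. Throughout,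
`s = q^{1/4}`. -/

section Matrices

variable {F : Type*} [Field F]

/-- The common shape of the braiding matrices. On `v_a ⊗ v_b` with `a`, `b` not complementary:
`v_a ⊗ v_a ↦ γ v_a ⊗ v_a`, `v_a ⊗ v_b ↦ v_b ⊗ v_a` if `a > b`, and
`v_a ⊗ v_b ↦ v_b ⊗ v_a + (γ - γ⁻¹) v_a ⊗ v_b` if `a < b`. If `a`, `b` are complementary, the
coefficient of a complementary pair `v_c ⊗ v_d` is `0` if `d < a`, it is `γ⁻¹` if `d = a`
(but `1` if `d = a = b = c`), and it is `β a d` if `a < d`. -/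
def braiding (N : ℕ) (γ : F) (β : ℕ → ℕ → F) :
    Matrix (Fin N × Fin N) (Fin N × Fin N) F :=
  Matrix.of fun (ab cd : Fin N × Fin N) =>
    let a := ab.1.val
    let b := ab.2.val
    let c := cd.1.val
    let d := cd.2.val
    if a + b + 1 ≠ N then
      if a = b then (if c = a ∧ d = b then γ else 0)
      else if c = b ∧ d = a then 1
      else if a < b ∧ c = a ∧ d = b then γ - γ⁻¹
      else 0
    else if c + d + 1 ≠ N then 0
    else if d < a then 0
    else if d = a then (if a = b then 1 else γ⁻¹)
    else β a d

/-- The antidiagonal matrix with the entry `μ a` in row `a`. -/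
def antidiagonal (N : ℕ) (μ : ℕ → F) : Matrix (Fin N) (Fin N) F :=
  Matrix.of fun a b => if a.val + b.val + 1 = N then μ a.val else 0

/-- The coefficients `β_{a,2n-a}^{2n-b,b}`, `a < b`, for `B_n`. -/
def betaB (n : ℕ) (s : F) (a b : ℕ) : F :=
  let x : ℤ := ((a : ℤ) - n) * ((b : ℤ) - n)
  if 0 < x then (s ^ 2 - (s ^ 2)⁻¹) * s ^ (-2 * ((a : ℤ) - b))
  else if x = 0 then (s ^ 2 - (s ^ 2)⁻¹) * s ^ (-2 * ((a : ℤ) - b) - 1)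
  else (s ^ 2 - (s ^ 2)⁻¹) * s ^ (-2 * ((a : ℤ) - b + 1)) +
    (if a + b = 2 * n then (s ^ 2)⁻¹ - s ^ 2 else 0)

/-- The braiding matrix of `B_n`. -/
def braidingB (n : ℕ) (s : F) :
    Matrix (Fin (2 * n + 1) × Fin (2 * n + 1)) (Fin (2 * n + 1) × Fin (2 * n + 1)) F :=
  braiding (2 * n + 1) (s ^ 2)⁻¹ (betaB n s)

/-- The fusion matrix of `B_n`: `𝓜_{a,2n-a}` is `q^{(n-a-1/2)/2}` for `a < n`, `1` for `a = n`, and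
`q^{(n-a+1/2)/2}` for `a > n`. -/
def fusionB (n : ℕ) (s : F) : Matrix (Fin (2 * n + 1)) (Fin (2 * n + 1)) F :=
  antidiagonal (2 * n + 1) fun a =>
    if a < n then s ^ (2 * ((n : ℤ) - a) - 1)
    else if a = n then 1
    else s ^ (2 * ((n : ℤ) - a) + 1)

/-- The coefficients `β_{a,2n-1-a}^{2n-1-b,b}`, `a < b`, for `C_n`. -/
def betaC (n : ℕ) (s : F) (a b : ℕ) : F :=
  if 0 < (2 * (a : ℤ) - 2 * n + 1) * (2 * (b : ℤ) - 2 * n + 1) then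
    (s - s⁻¹) * s ^ (-((a : ℤ) - b))
  else (s⁻¹ - s) * s ^ (-((a : ℤ) - b - 1)) + (if a + b + 1 = 2 * n then s⁻¹ - s else 0)

/-- The braiding matrix of `C_n`. -/
def braidingC (n : ℕ) (s : F) :
    Matrix (Fin (2 * n) × Fin (2 * n)) (Fin (2 * n) × Fin (2 * n)) F :=
  braiding (2 * n) s⁻¹ (betaC n s)

/-- The fusion matrix of `C_n`, where `I` is a square root of `-1`: `𝓜_{a,2n-1-a}` is
`-I q^{(n-a)/4}` for `a < n` and `I q^{(n-a-1)/4}` for `a ≥ n`. -/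
def fusionC (n : ℕ) (I s : F) : Matrix (Fin (2 * n)) (Fin (2 * n)) F :=
  antidiagonal (2 * n) fun a =>
    if a < n then -I * s ^ ((n : ℤ) - a) else I * s ^ ((n : ℤ) - a - 1)

/-- The coefficients `β_{a,2n-1-a}^{2n-1-b,b}`, `a < b`, for `D_n` (states named by their order). -/
def betaD (n : ℕ) (s : F) (a b : ℕ) : F :=
  if 0 < (2 * (a : ℤ) - 2 * n + 1) * (2 * (b : ℤ) - 2 * n + 1) then
    (s ^ 2 - (s ^ 2)⁻¹) * s ^ (-2 * ((a : ℤ) - b))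
  else (s ^ 2 - (s ^ 2)⁻¹) * s ^ (-2 * ((a : ℤ) - b + 1)) +
    (if a + b + 1 = 2 * n then (s ^ 2)⁻¹ - s ^ 2 else 0)

/-- The braiding matrix of `D_n`. -/
def braidingD (n : ℕ) (s : F) :
    Matrix (Fin (2 * n) × Fin (2 * n)) (Fin (2 * n) × Fin (2 * n)) F :=
  braiding (2 * n) (s ^ 2)⁻¹ (betaD n s)

/-- The fusion matrix of `D_n`: `𝓜_{a,2n-1-a}` is `q^{(n-a-1)/2}` for `a < n` and `q^{(n-a)/2}` for
`a ≥ n`. -/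
def fusionD (n : ℕ) (s : F) : Matrix (Fin (2 * n)) (Fin (2 * n)) F :=
  antidiagonal (2 * n) fun a =>
    if a < n then s ^ (2 * ((n : ℤ) - a - 1)) else s ^ (2 * ((n : ℤ) - a))

end Matrices

end LinkSum

/-!
The state sum is the composition of one linear operator for each slice, acting on functions of the
row of states, so each axiom reduces to an identity between the amplitudes of a few neighbouring
events. The states are labelled by integers symmetric about `0`, complementary states having
opposite labels; negating the labels and inverting `γ` turns `ℬ` into the opposite crossing.

A rotation by a right angle exchanges the two crossings, which gives the moves through maxima and
minima. Their product is `1` by the skein relation, the eigenvalue equation for the curl, and the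
quadratic relation `ℬ² = 1 - z ℬ + z α 𝒫`, where `𝒫` is a maximum followed by a minimum.

For the braid relation, a rotation of all three strands together with the skein relation turns the
relation for `ℬ` into that for the opposite crossing, so any of the six outer states can be moved
to any position. A state of extreme label passes through the crossings freely when it enters on
the right. If no outer state is extreme, then neither is any inner one, and what remains is the
relation for the braiding of the other states.
-/

namespace LinkSum

open Matrix

/-! ### The state sum as a composition of linear operators -/

lemma exists_append_eq {ι : Type*} {st : List ι} {i j : ℕ} (h : i + j ≤ st.length) :
    ∃ l x r : List ι, i = l.length ∧ x.length = j ∧ st = l ++ x ++ r :=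
  ⟨st.take i, (st.drop i).take j, (st.drop i).drop j, by simp; omega, by simp; omega, by simp⟩

lemma IsTangle.exists_of_append {m n : ℕ} {u v : List Slice}
    (h : IsTangle m (u ++ v) n) : ∃ k, IsTangle m u k ∧ IsTangle k v n := by
  induction u generalizing m with
  | nil => exact ⟨m, rfl, h⟩
  | cons p u ih =>
    obtain ⟨k, hu, hv⟩ := ih h.2
    exact ⟨k, ⟨h.1, hu⟩, hv⟩

/-- The amplitudes of the elementary events: lower indices (states before the event) are rows and
upper indices (states after the event) are columns, as in `amplitude`; `crossing true` belongs
to `X₊` and `crossing false` to `X₋`. -/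
structure Amplitudes (F ι : Type*) where
  creation : ι × ι → F
  annihilation : ι × ι → F
  crossing : Bool → Matrix (ι × ι) (ι × ι) F

namespace Amplitudes

variable {F ι : Type*} [Field F] [Fintype ι] (V : Amplitudes F ι)

/-- The superposition of rows of states into which an event turns the row `x` of the states of the
strands that take part in it; it is `0` if the number of these strands is wrong. -/
noncomputable def outcome : Kind → List ι → List ι →₀ F
  | .cup, [] => ∑ a, ∑ b, .single [a, b] (V.creation (a, b))
  | .cap, [a, b] => .single [] (V.annihilation (a, b))
  | .cross e, [a, b] => ∑ c, ∑ d, .single [c, d] (V.crossing e (a, b) (c, d))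
  | _, _ => 0

lemma outcome_apply_of_length_ne (p : Kind) (x : List ι) {y : List ι}
    (hy : y.length ≠ p.outputs) : V.outcome p x y = 0 := by
  classical
  unfold outcome
  have single_apply {z : List ι} (hz : z.length = p.outputs) (c : F) :
      Finsupp.single z c y = 0 := Finsupp.single_eq_of_ne (by grind)
  split
  · simp only [Finsupp.finsetSum_apply]
    exact Finset.sum_eq_zero fun _ _ => Finset.sum_eq_zero fun _ _ => single_apply rfl _
  · exact single_apply rfl _
  · simp only [Finsupp.finsetSum_apply]
    exact Finset.sum_eq_zero fun _ _ => Finset.sum_eq_zero fun _ _ => single_apply rfl _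
  · rfl

lemma linearCombination_outcome_congr (p : Kind) (x : List ι) {f g : List ι → F}
    (h : ∀ y : List ι, y.length = p.outputs → f y = g y) :
    Finsupp.linearCombination F f (V.outcome p x) =
      Finsupp.linearCombination F g (V.outcome p x) := by
  simp only [Finsupp.linearCombination_apply]
  refine Finsupp.sum_congr fun y hy => ?_
  rw [h y (of_not_not fun hy' => (Finsupp.mem_support_iff.1 hy)
    (V.outcome_apply_of_length_ne p x hy'))]

/-- The action of a slice on functions of the row of states. -/
noncomputable def sliceOp (p : Slice) : (List ι → F) →ₗ[F] (List ι → F) where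
  toFun f st := Finsupp.linearCombination F
    (fun y => f (st.take p.pos ++ (y ++ st.drop (p.pos + p.kind.inputs))))
    (V.outcome p.kind ((st.drop p.pos).take p.kind.inputs))
  map_add' f g := by
    ext st
    simp [Finsupp.linearCombination_apply, mul_add]
  map_smul' c f := by
    ext st
    simp [Finsupp.linearCombination_apply, Finsupp.mul_sum, mul_left_comm]

lemma sliceOp_append (p : Kind) (f : List ι → F) (l x r : List ι) (hx : x.length = p.inputs) :
    V.sliceOp ⟨p, l.length⟩ f (l ++ (x ++ r)) =
      Finsupp.linearCombination F (fun y => f (l ++ (y ++ r))) (V.outcome p x) := by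
  simp [sliceOp, ← hx]

/-- The action of a diagram on functions of the row of states at its top; the result is a function
of the row at its bottom, so the last slice acts first. -/
noncomputable def wordOp : List Slice → (List ι → F) →ₗ[F] (List ι → F)
  | [] => LinearMap.id
  | p :: w => V.sliceOp p ∘ₗ wordOp w

lemma wordOp_append (u v : List Slice) : V.wordOp (u ++ v) = V.wordOp u ∘ₗ V.wordOp v := by
  induction u with
  | nil => rfl
  | cons p u ih => simp only [List.cons_append, wordOp, ih, LinearMap.comp_assoc]

/-- The function that singles out the row without strands. -/
def vacuum : List ι → F
  | [] => 1
  | _ :: _ => 0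

/-- The vacuum expectation of a diagram, in terms of operators. -/
noncomputable def expectation (K : LinkDiagram) : F := V.wordOp K.word vacuum []

lemma amplitude_eq_wordOp (B B' : Matrix (ι × ι) (ι × ι) F) (M M' : Matrix ι ι F)
    (w : List Slice) (st : List ι) :
    amplitude B B' M M' w st =
      (⟨fun p => M' p.1 p.2, fun p => M p.1 p.2, fun e => bif e then B else B'⟩ :
        Amplitudes F ι).wordOp w vacuum st := by
  induction w generalizing st with
  | nil => cases st <;> rfl
  | cons p w ih =>
    obtain ⟨p, i⟩ := p
    rcases p with _ | _ | e
    · simp [amplitude, wordOp, sliceOp, outcome, ih, Kind.inputs]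
    · rcases h : st.drop i with _ | ⟨a, _ | ⟨b, r⟩⟩ <;>
        simp [amplitude, wordOp, sliceOp, outcome, ih, Kind.inputs, h, ← List.drop_drop]
    · rcases h : st.drop i with _ | ⟨a, _ | ⟨b, r⟩⟩ <;> cases e <;>
        simp [amplitude, wordOp, sliceOp, outcome, ih, Kind.inputs, h, ← List.drop_drop]

lemma vacuumExpectation_eq_expectation [DecidableEq ι] (B : Matrix (ι × ι) (ι × ι) F)
    (M : Matrix ι ι F) :
    vacuumExpectation B M =
      (⟨fun p => M⁻¹ p.1 p.2, fun p => M p.1 p.2, fun e => bif e then B else B⁻¹⟩ :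
        Amplitudes F ι).expectation :=
  funext fun _ => amplitude_eq_wordOp _ _ _ _ _ _

lemma wordOp_eq_zero {m n : ℕ} {u : List Slice} (hu : IsTangle m u n) {f : List ι → F}
    (hf : ∀ st, st.length = n → f st = 0) {st : List ι} (hst : st.length = m) :
    V.wordOp u f st = 0 := by
  induction u generalizing st m with
  | nil => exact hf _ (hst.trans hu)
  | cons p w ih =>
    obtain ⟨hp, hw⟩ := hu
    refine (V.linearCombination_outcome_congr (g := 0) p.kind _ fun y hy => ih hw ?_).trans
      (by simp)
    simp only [List.length_append, List.length_take, List.length_drop]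
    omega

lemma wordOp_apply_eq_zero_of_local {K : LinkDiagram} {u x v : List Slice}
    (hK : K.word = u ++ x ++ v) {T : (List ι → F) →ₗ[F] (List ι → F)}
    (hT : ∀ n f st, IsTangle st.length x n → T f st = 0) :
    V.wordOp u (T (V.wordOp v vacuum)) [] = 0 := by
  obtain ⟨k, hux, -⟩ := (hK ▸ K.closed).exists_of_append
  obtain ⟨m, hu, hx⟩ := hux.exists_of_append
  exact V.wordOp_eq_zero hu (fun st hst => hT k _ st (hst ▸ hx)) rfl

lemma expectation_eq_mul_of_local {u x y v : List Slice} {K K' : LinkDiagram}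
    (hK : K.word = u ++ x ++ v) (hK' : K'.word = u ++ y ++ v) {c : F}
    (h : ∀ n f st, IsTangle st.length x n → V.wordOp x f st = c * V.wordOp y f st) :
    V.expectation K = c * V.expectation K' := by
  have key := V.wordOp_apply_eq_zero_of_local hK (T := V.wordOp x - c • V.wordOp y)
    fun n f st hx => by simp [h n f st hx]
  rw [LinearMap.sub_apply, map_sub, LinearMap.smul_apply, map_smul] at key
  simp only [expectation, hK, hK', wordOp_append, LinearMap.comp_apply]
  exact sub_eq_zero.1 key

lemma sliceOp_cup (f : List ι → F) (l r : List ι) :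
    V.sliceOp (cup l.length) f (l ++ r) =
      V.creation ⬝ᵥ fun p => f (l ++ p.1 :: p.2 :: r) := by
  simpa [cup, outcome, dotProduct, Fintype.sum_prod_type] using
    V.sliceOp_append .cup f l [] r rfl

lemma sliceOp_cap (f : List ι → F) (l r : List ι) (a b : ι) :
    V.sliceOp (cap l.length) f (l ++ a :: b :: r) = V.annihilation (a, b) * f (l ++ r) := by
  simpa [cap, outcome] using V.sliceOp_append .cap f l [a, b] r rfl

lemma sliceOp_cross (e : Bool) (f : List ι → F) (l r : List ι) (a b : ι) :
    V.sliceOp (cross e l.length) f (l ++ a :: b :: r) =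
      (V.crossing e *ᵥ fun p => f (l ++ p.1 :: p.2 :: r)) (a, b) := by
  simpa [cross, outcome, mulVec, dotProduct, Fintype.sum_prod_type] using
    V.sliceOp_append (.cross e) f l [a, b] r rfl

lemma sliceOp_cup_succ (f : List ι → F) (l r : List ι) (x : ι) :
    V.sliceOp (cup (l.length + 1)) f (l ++ x :: r) =
      V.creation ⬝ᵥ fun p => f (l ++ x :: p.1 :: p.2 :: r) := by
  simpa using V.sliceOp_cup f (l ++ [x]) r

lemma sliceOp_cap_succ (f : List ι → F) (l r : List ι) (x a b : ι) :
    V.sliceOp (cap (l.length + 1)) f (l ++ x :: a :: b :: r) =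
      V.annihilation (a, b) * f (l ++ x :: r) := by
  simpa using V.sliceOp_cap f (l ++ [x]) r a b

lemma sliceOp_cross_succ (e : Bool) (f : List ι → F) (l r : List ι) (x a b : ι) :
    V.sliceOp (cross e (l.length + 1)) f (l ++ x :: a :: b :: r) =
      (V.crossing e *ᵥ fun p => f (l ++ x :: p.1 :: p.2 :: r)) (a, b) := by
  simpa using V.sliceOp_cross e f (l ++ [x]) r a b

lemma wordOp_exchange (p q : Kind) (i k : ℕ) (f : List ι → F) {st : List ι}
    (h₁ : i + p.inputs ≤ st.length)
    (h₂ : i + p.outputs + k + q.inputs ≤ st.length - p.inputs + p.outputs) :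
    V.wordOp [⟨p, i⟩, ⟨q, i + p.outputs + k⟩] f st =
      V.wordOp [⟨q, i + p.inputs + k⟩, ⟨p, i⟩] f st := by
  obtain ⟨l, x, r', rfl, hx, rfl⟩ := exists_append_eq h₁
  simp only [List.length_append] at h₂
  obtain ⟨m, y, r, rfl, hy, rfl⟩ := exists_append_eq (show k + q.inputs ≤ r'.length by omega)
  have hq (x' : List ι) (g : List ι → F) :
      V.sliceOp ⟨q, l.length + x'.length + m.length⟩ g (l ++ (x' ++ (m ++ (y ++ r)))) =
        Finsupp.linearCombination F (fun y' => g (l ++ (x' ++ (m ++ (y' ++ r)))))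
          (V.outcome q y) := by
    simpa [add_assoc] using V.sliceOp_append q g (l ++ (x' ++ m)) y r hy
  simp only [wordOp, LinearMap.comp_apply, LinearMap.id_apply, List.append_assoc]
  rw [V.sliceOp_append _ _ _ _ _ hx, ← hx, hq,
    V.linearCombination_outcome_congr p x fun x' hx' => by rw [← hx', hq]]
  simp only [V.sliceOp_append _ _ _ _ _ hx, Finsupp.linearCombination_apply, Finsupp.smul_sum]
  rw [Finsupp.sum_comm]
  exact Finsupp.sum_congr fun y' _ => Finsupp.sum_congr fun x' _ => smul_comm _ _ _

end Amplitudes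

/-! ### Operators on three strands -/

section BraidRelation

variable {G : Type*} [Group G] {u v : G}

lemma mul_mul_inv_eq_of_braid (h : u * v * u = v * u * v) : u * v * u⁻¹ = v⁻¹ * u * v := by
  rw [mul_inv_eq_iff_eq_mul, mul_assoc, mul_assoc, eq_inv_mul_iff_mul_eq]
  simpa only [mul_assoc] using h.symm

lemma inv_mul_mul_eq_of_braid (h : u * v * u = v * u * v) : u⁻¹ * v * u = v * u * v⁻¹ := by
  rw [eq_mul_inv_iff_mul_eq, mul_assoc, mul_assoc, inv_mul_eq_iff_eq_mul]
  simpa only [mul_assoc] using h.symm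

lemma inv_braid_of_braid (h : u * v * u = v * u * v) : u⁻¹ * v⁻¹ * u⁻¹ = v⁻¹ * u⁻¹ * v⁻¹ := by
  simpa only [_root_.mul_inv_rev, mul_assoc] using congrArg (·⁻¹) h

lemma braid_relation_signs {M : Type*} [Monoid M] {x y : Bool → M} (hx : ∀ e, x e * x (!e) = 1)
    (hy : ∀ e, y e * y (!e) = 1) (h : x true * y true * x true = y true * x true * y true)
    {e₁ e₂ e₃ : Bool} (he : e₁ = e₂ ∨ e₂ = e₃) : x e₁ * y e₂ * x e₃ = y e₃ * x e₂ * y e₁ := by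
  let X : Mˣ := ⟨x true, x false, hx true, hx false⟩
  let Y : Mˣ := ⟨y true, y false, hy true, hy false⟩
  have H : X * Y * X = Y * X * Y := Units.ext h
  have Hinv := inv_braid_of_braid H
  rcases e₁ <;> rcases e₂ <;> rcases e₃ <;> simp only [reduceCtorEq, or_self] at he
  exacts [congrArg Units.val Hinv, congrArg Units.val (mul_mul_inv_eq_of_braid Hinv),
    congrArg Units.val (inv_mul_mul_eq_of_braid H),
    congrArg Units.val (inv_mul_mul_eq_of_braid Hinv),
    congrArg Units.val (mul_mul_inv_eq_of_braid H), h]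

end BraidRelation

section ThreeStrands

open scoped Kronecker

variable {F ι : Type*} [Field F] [Fintype ι] [DecidableEq ι]

/-- A matrix on two strands, acting on the first two of three strands. -/
def leftOf : Matrix (ι × ι) (ι × ι) F →ₐ[F] Matrix (ι × ι × ι) (ι × ι × ι) F :=
  (reindexAlgEquiv F F (Equiv.prodAssoc ι ι ι)).toAlgHom.comp <|
    AlgHom.ofLinearMap
      { toFun := fun A => A ⊗ₖ (1 : Matrix ι ι F)
        map_add' := fun A B => add_kronecker A B 1
        map_smul' := fun c A => smul_kronecker c A 1 }
      one_kronecker_one fun A B => by simp [← mul_kronecker_mul]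

/-- A matrix on two strands, acting on the last two of three strands. -/
def rightOf : Matrix (ι × ι) (ι × ι) F →ₐ[F] Matrix (ι × ι × ι) (ι × ι × ι) F :=
  AlgHom.ofLinearMap
    { toFun := fun A => (1 : Matrix ι ι F) ⊗ₖ A
      map_add' := fun A B => kronecker_add 1 A B
      map_smul' := fun c A => kronecker_smul c 1 A }
    one_kronecker_one fun A B => by simp [← mul_kronecker_mul]

lemma leftOf_apply (A : Matrix (ι × ι) (ι × ι) F) (a b c d e f : ι) :
    leftOf A (a, b, c) (d, e, f) = if c = f then A (a, b) (d, e) else 0 := by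
  simp [leftOf, one_apply]

lemma rightOf_apply (A : Matrix (ι × ι) (ι × ι) F) (a b c d e f : ι) :
    rightOf A (a, b, c) (d, e, f) = if a = d then A (b, c) (e, f) else 0 := by
  simp [rightOf, one_apply]

lemma leftOf_mulVec (A : Matrix (ι × ι) (ι × ι) F) (g : ι × ι × ι → F) (a b c : ι) :
    (leftOf A *ᵥ g) (a, b, c) = (A *ᵥ fun p => g (p.1, p.2, c)) (a, b) := by
  simp [mulVec, dotProduct, Fintype.sum_prod_type, leftOf_apply]

lemma rightOf_mulVec (A : Matrix (ι × ι) (ι × ι) F) (g : ι × ι × ι → F) (a b c : ι) :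
    (rightOf A *ᵥ g) (a, b, c) = (A *ᵥ fun p => g (a, p.1, p.2)) (b, c) := by
  simp only [mulVec, dotProduct, Fintype.sum_prod_type, rightOf_apply, ite_mul, zero_mul]
  rw [Fintype.sum_eq_single a fun d hd => by simp [hd.symm]]
  simp only [if_true]

end ThreeStrands

/-! ### Local relations imply the axioms -/

/-- The local relations between the amplitudes of the events that make the state sum a
specialization of the Kauffman polynomial. -/
structure Amplitudes.SatisfiesKauffmanRelations {F ι : Type*} [Field F] [Fintype ι] [DecidableEq ι]
    (V : Amplitudes F ι) (z α : F) : Prop where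
  cancel : ∀ e, V.crossing e * V.crossing (!e) = 1
  braid : leftOf (V.crossing true) * rightOf (V.crossing true) * leftOf (V.crossing true) =
    rightOf (V.crossing true) * leftOf (V.crossing true) * rightOf (V.crossing true)
  zigzag_left : ∀ a c, ∑ b, V.annihilation (a, b) * V.creation (b, c) = if a = c then 1 else 0
  zigzag_right : ∀ a c, ∑ b, V.creation (a, b) * V.annihilation (b, c) = if a = c then 1 else 0
  slide_annihilation : ∀ e a b c d, ∑ w, V.crossing e (a, b) (d, w) * V.annihilation (w, c) =
    ∑ w, V.crossing (!e) (b, c) (w, d) * V.annihilation (a, w)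
  slide_creation : ∀ e a b c d, ∑ w, V.creation (a, w) * V.crossing e (w, b) (c, d) =
    ∑ w, V.creation (w, d) * V.crossing (!e) (b, w) (a, c)
  skein : V.crossing true - V.crossing false =
    z • (vecMulVec V.annihilation V.creation - 1)
  curl_annihilation : V.crossing true *ᵥ V.annihilation = α • V.annihilation
  curl_creation : V.creation ᵥ* V.crossing true = α • V.creation

namespace Amplitudes.SatisfiesKauffmanRelations

variable {F ι : Type*} [Field F] [Fintype ι] [DecidableEq ι] {V : Amplitudes F ι} {z α : F}

lemma wordOp_zigzagRight (H : V.SatisfiesKauffmanRelations z α) (f : List ι → F)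
    (l r : List ι) (a : ι) :
    V.wordOp [cup l.length, cap (l.length + 1)] f (l ++ a :: r) = f (l ++ a :: r) := by
  simp only [wordOp, LinearMap.comp_apply, LinearMap.id_apply, sliceOp_cup, sliceOp_cap_succ,
    dotProduct, Fintype.sum_prod_type, ← mul_assoc, ← Finset.sum_mul, H.zigzag_right]
  simp

lemma wordOp_zigzagLeft (H : V.SatisfiesKauffmanRelations z α) (f : List ι → F)
    (l r : List ι) (a : ι) :
    V.wordOp [cup (l.length + 1), cap l.length] f (l ++ a :: r) = f (l ++ a :: r) := by
  simp only [wordOp, LinearMap.comp_apply, LinearMap.id_apply, sliceOp_cup_succ, sliceOp_cap,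
    dotProduct, Fintype.sum_prod_type_right, ← mul_assoc,
    mul_comm (V.creation (_, _)) (V.annihilation _), ← Finset.sum_mul, H.zigzag_left]
  simp

lemma wordOp_slideCap (H : V.SatisfiesKauffmanRelations z α) (e : Bool) (f : List ι → F)
    (l r : List ι) (a b c : ι) :
    V.wordOp [cross e l.length, cap (l.length + 1)] f (l ++ a :: b :: c :: r) =
      V.wordOp [cross (!e) (l.length + 1), cap l.length] f (l ++ a :: b :: c :: r) := by
  simp only [wordOp, LinearMap.comp_apply, LinearMap.id_apply, sliceOp_cross, sliceOp_cap_succ,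
    sliceOp_cross_succ, sliceOp_cap, mulVec, dotProduct, ← mul_assoc]
  rw [Fintype.sum_prod_type, Fintype.sum_prod_type_right]
  simp only [← Finset.sum_mul, H.slide_annihilation]

lemma wordOp_slideCup (H : V.SatisfiesKauffmanRelations z α) (e : Bool) (f : List ι → F)
    (l r : List ι) (x : ι) : V.wordOp [cup l.length, cross e (l.length + 1)] f (l ++ x :: r) =
      V.wordOp [cup (l.length + 1), cross (!e) l.length] f (l ++ x :: r) := by
  simp only [wordOp, LinearMap.comp_apply, LinearMap.id_apply, sliceOp_cross, sliceOp_cup_succ,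
    sliceOp_cross_succ, sliceOp_cup, mulVec, dotProduct]
  calc ∑ p : ι × ι, V.creation p * ∑ q, V.crossing e (p.2, x) q * f (l ++ p.1 :: q.1 :: q.2 :: r)
    _ = ∑ a, ∑ c, ∑ d, (∑ w, V.creation (a, w) * V.crossing e (w, x) (c, d)) *
          f (l ++ a :: c :: d :: r) := by
        simp only [Fintype.sum_prod_type, Finset.mul_sum, Finset.sum_mul, mul_assoc]
        exact Finset.sum_congr rfl fun a _ => Finset.sum_comm_cycle.symm
    _ = ∑ a, ∑ c, ∑ d, (∑ w, V.creation (w, d) * V.crossing (!e) (x, w) (a, c)) *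
          f (l ++ a :: c :: d :: r) := by
        simp only [H.slide_creation]
    _ = _ := by
        simp only [Fintype.sum_prod_type, Finset.mul_sum, Finset.sum_mul, mul_assoc]
        symm
        rw [Finset.sum_comm_cycle]
        refine Finset.sum_congr rfl fun a _ => ?_
        rw [Finset.sum_comm_cycle]
        exact Finset.sum_congr rfl fun c _ => Finset.sum_comm

lemma cancel_mulVec (H : V.SatisfiesKauffmanRelations z α) (e : Bool) (g : ι × ι → F) :
    V.crossing e *ᵥ V.crossing (!e) *ᵥ g = g := by
  rw [mulVec_mulVec, H.cancel, one_mulVec]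

lemma wordOp_reidemeisterII (H : V.SatisfiesKauffmanRelations z α) (e : Bool) (f : List ι → F)
    (l r : List ι) (a b : ι) :
    V.wordOp [cross e l.length, cross (!e) l.length] f (l ++ a :: b :: r) =
      f (l ++ a :: b :: r) := by
  simp only [wordOp, LinearMap.comp_apply, LinearMap.id_apply, sliceOp_cross]
  exact congrFun (H.cancel_mulVec e fun p => f (l ++ p.1 :: p.2 :: r)) (a, b)

lemma wordOp_reidemeisterIII (H : V.SatisfiesKauffmanRelations z α) {e₁ e₂ e₃ : Bool}
    (h : e₁ = e₂ ∨ e₂ = e₃) (f : List ι → F) (l r : List ι) (a b c : ι) :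
    V.wordOp [cross e₁ l.length, cross e₂ (l.length + 1), cross e₃ l.length] f
        (l ++ a :: b :: c :: r) =
      V.wordOp [cross e₃ (l.length + 1), cross e₂ l.length, cross e₁ (l.length + 1)] f
        (l ++ a :: b :: c :: r) := by
  have braid := braid_relation_signs (x := fun e => leftOf (V.crossing e))
    (y := fun e => rightOf (V.crossing e)) (fun e => by rw [← map_mul, H.cancel, map_one])
    (fun e => by rw [← map_mul, H.cancel, map_one]) H.braid h
  have := congrFun (congrArg (· *ᵥ fun p : ι × ι × ι => f (l ++ p.1 :: p.2.1 :: p.2.2 :: r)) braid)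
    (a, b, c)
  simp only [wordOp, LinearMap.comp_apply, LinearMap.id_apply, sliceOp_cross, sliceOp_cross_succ]
  simpa only [← mulVec_mulVec, leftOf_mulVec, rightOf_mulVec] using this

lemma annihilation_ne_zero [Nonempty ι] (H : V.SatisfiesKauffmanRelations z α) :
    V.annihilation ≠ 0 := by
  intro h
  simpa [h] using H.zigzag_left (Classical.arbitrary ι) (Classical.arbitrary ι)

lemma alpha_ne_zero [Nonempty ι] (H : V.SatisfiesKauffmanRelations z α) : α ≠ 0 := by
  rintro rfl
  refine H.annihilation_ne_zero ?_
  rw [← H.cancel_mulVec false V.annihilation, Bool.not_false, H.curl_annihilation, zero_smul,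
    mulVec_zero]

lemma curl_annihilation_signs [Nonempty ι] (H : V.SatisfiesKauffmanRelations z α) (e : Bool) :
    V.crossing e *ᵥ V.annihilation = (bif e then α else α⁻¹) • V.annihilation := by
  cases e
  · have := H.cancel_mulVec false V.annihilation
    rwa [Bool.not_false, H.curl_annihilation, mulVec_smul, ← eq_inv_smul_iff₀ H.alpha_ne_zero]
      at this
  · exact H.curl_annihilation

lemma curl_creation_signs [Nonempty ι] (H : V.SatisfiesKauffmanRelations z α) (e : Bool) :
    V.creation ᵥ* V.crossing e = (bif e then α else α⁻¹) • V.creation := by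
  cases e
  · have : V.creation ᵥ* V.crossing true ᵥ* V.crossing false = V.creation := by
      rw [vecMul_vecMul, ← Bool.not_true, H.cancel, vecMul_one]
    rwa [H.curl_creation, smul_vecMul, ← eq_inv_smul_iff₀ H.alpha_ne_zero] at this
  · exact H.curl_creation

/-- Applying the skein relation to a maximum evaluates the circle. -/
lemma creation_dotProduct_annihilation [Nonempty ι] (H : V.SatisfiesKauffmanRelations z α)
    (hz : z ≠ 0) : V.creation ⬝ᵥ V.annihilation = (α - α⁻¹) / z + 1 := by
  obtain ⟨p, hp⟩ := Function.ne_iff.1 H.annihilation_ne_zero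
  have h := congrFun (congrArg (· *ᵥ V.annihilation) H.skein) p
  simp only [sub_mulVec, smul_mulVec, H.curl_annihilation_signs, vecMulVec_mulVec, one_mulVec,
    Pi.sub_apply, Pi.smul_apply, smul_eq_mul, cond_true, cond_false, MulOpposite.smul_eq_mul_unop,
    MulOpposite.unop_op] at h
  have h : α - α⁻¹ = z * (V.creation ⬝ᵥ V.annihilation - 1) :=
    mul_right_cancel₀ hp (by linear_combination h)
  rw [h, mul_div_cancel_left₀ _ hz, sub_add_cancel]

lemma wordOp_eq_of_planarMove (H : V.SatisfiesKauffmanRelations z α) {x y : List Slice}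
    (hxy : PlanarMove x y) {n : ℕ} (f : List ι → F) {st : List ι} (hx : IsTangle st.length x n) :
    V.wordOp x f st = V.wordOp y f st := by
  cases hxy with
  | exchange p q i k => exact V.wordOp_exchange p q i k f hx.1 hx.2.1
  | zigzagRight i =>
    simp only [IsTangle, cup, cap, Kind.inputs, Kind.outputs] at hx
    obtain ⟨l, x, r, rfl, hlen, rfl⟩ := exists_append_eq (show i + 1 ≤ st.length by omega)
    obtain ⟨a, rfl⟩ := List.length_eq_one_iff.1 hlen
    simpa [wordOp] using H.wordOp_zigzagRight f l r a
  | zigzagLeft i =>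
    simp only [IsTangle, cup, cap, Kind.inputs, Kind.outputs] at hx
    obtain ⟨l, x, r, rfl, hlen, rfl⟩ := exists_append_eq (show i + 1 ≤ st.length by omega)
    obtain ⟨a, rfl⟩ := List.length_eq_one_iff.1 hlen
    simpa [wordOp] using H.wordOp_zigzagLeft f l r a
  | slideCap e i =>
    simp only [IsTangle, cross, cap, Kind.inputs, Kind.outputs] at hx
    obtain ⟨l, x, r, rfl, hlen, rfl⟩ := exists_append_eq (show i + 3 ≤ st.length by omega)
    obtain ⟨a, b, c, rfl⟩ := List.length_eq_three.1 hlen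
    simpa using H.wordOp_slideCap e f l r a b c
  | slideCup e i =>
    simp only [IsTangle, cross, cup, Kind.inputs, Kind.outputs] at hx
    obtain ⟨l, x, r, rfl, hlen, rfl⟩ := exists_append_eq (show i + 1 ≤ st.length by omega)
    obtain ⟨a, rfl⟩ := List.length_eq_one_iff.1 hlen
    simpa using H.wordOp_slideCup e f l r a

lemma wordOp_eq_of_reidemeisterII (H : V.SatisfiesKauffmanRelations z α) {x y : List Slice}
    (hxy : ReidemeisterII x y) {n : ℕ} (f : List ι → F) {st : List ι}
    (hx : IsTangle st.length x n) : V.wordOp x f st = V.wordOp y f st := by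
  obtain ⟨e, i⟩ := hxy
  obtain ⟨l, x, r, rfl, hlen, rfl⟩ := exists_append_eq hx.1
  obtain ⟨a, b, rfl⟩ := List.length_eq_two.1 hlen
  simpa [wordOp] using H.wordOp_reidemeisterII e f l r a b

lemma wordOp_eq_of_reidemeisterIII (H : V.SatisfiesKauffmanRelations z α) {x y : List Slice}
    (hxy : ReidemeisterIII x y) {n : ℕ} (f : List ι → F) {st : List ι}
    (hx : IsTangle st.length x n) : V.wordOp x f st = V.wordOp y f st := by
  obtain ⟨e₁, e₂, e₃, h, i⟩ := hxy
  simp only [IsTangle, cross, Kind.inputs, Kind.outputs] at hx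
  obtain ⟨l, x, r, rfl, hlen, rfl⟩ := exists_append_eq (show i + 3 ≤ st.length by omega)
  obtain ⟨a, b, c, rfl⟩ := List.length_eq_three.1 hlen
  simpa using H.wordOp_reidemeisterIII h f l r a b c

lemma expectation_eq_of_step (H : V.SatisfiesKauffmanRelations z α) {K K' : LinkDiagram}
    (h : Step K K') : V.expectation K = V.expectation K' := by
  obtain ⟨u, x, y, v, hxy, hK, hK'⟩ := h
  rw [V.expectation_eq_mul_of_local hK hK' (c := 1) fun n f st hx => ?_, one_mul]
  rw [one_mul]
  rcases hxy with h | h | h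
  exacts [H.wordOp_eq_of_planarMove h f hx, H.wordOp_eq_of_reidemeisterII h f hx,
    H.wordOp_eq_of_reidemeisterIII h f hx]

lemma expectation_skein (H : V.SatisfiesKauffmanRelations z α) {u v : List Slice} {i : ℕ}
    {Lp Lm Linf L0 : LinkDiagram} (hp : Lp.word = u ++ [cross true i] ++ v)
    (hm : Lm.word = u ++ [cross false i] ++ v) (hinf : Linf.word = u ++ [cap i, cup i] ++ v)
    (h0 : L0.word = u ++ v) :
    V.expectation Lp - V.expectation Lm = z * (V.expectation Linf - V.expectation L0) := by
  have key := V.wordOp_apply_eq_zero_of_local hp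
    (T := V.wordOp [cross true i] - V.wordOp [cross false i] -
      z • (V.wordOp [cap i, cup i] - LinearMap.id)) fun n f st hx => ?_
  · simp only [LinearMap.sub_apply, LinearMap.smul_apply, LinearMap.id_apply, map_sub, map_smul,
      Pi.sub_apply, Pi.smul_apply, smul_eq_mul] at key
    simp only [expectation, hp, hm, hinf, h0, wordOp_append, LinearMap.comp_apply]
    exact sub_eq_zero.1 key
  · obtain ⟨l, x, r, rfl, hlen, rfl⟩ := exists_append_eq hx.1
    obtain ⟨a, b, rfl⟩ := List.length_eq_two.1 hlen
    have skein := congrFun (congrArg (· *ᵥ fun p : ι × ι => f (l ++ p.1 :: p.2 :: r)) H.skein)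
      (a, b)
    simp only [sub_mulVec, smul_mulVec, vecMulVec_mulVec, one_mulVec, Pi.sub_apply, Pi.smul_apply,
      smul_eq_mul, MulOpposite.smul_eq_mul_unop, MulOpposite.unop_op] at skein
    simp only [LinearMap.sub_apply, LinearMap.smul_apply, LinearMap.id_apply, Pi.sub_apply,
      Pi.smul_apply, smul_eq_mul, wordOp, LinearMap.comp_apply, List.append_assoc,
      List.cons_append, List.nil_append, sliceOp_cross, sliceOp_cap, sliceOp_cup]
    exact sub_eq_zero.2 skein

lemma expectation_circle [Nonempty ι] (H : V.SatisfiesKauffmanRelations z α) (hz : z ≠ 0) :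
    V.expectation circle = (α - α⁻¹) / z + 1 := by
  rw [← H.creation_dotProduct_annihilation hz, expectation]
  refine (V.sliceOp_cup _ [] []).trans (congrArg (V.creation ⬝ᵥ ·) (funext fun p => ?_))
  exact (V.sliceOp_cap vacuum [] [] p.1 p.2).trans (mul_one _)

lemma expectation_curl_cap [Nonempty ι] (H : V.SatisfiesKauffmanRelations z α) {e : Bool}
    {u v : List Slice} {i : ℕ} {W' W : LinkDiagram}
    (hW' : W'.word = u ++ [cross e i, cap i] ++ v) (hW : W.word = u ++ [cap i] ++ v) :
    V.expectation W' = (bif e then α else α⁻¹) * V.expectation W := by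
  refine V.expectation_eq_mul_of_local hW' hW fun n f st hx => ?_
  obtain ⟨l, x, r, rfl, hlen, rfl⟩ := exists_append_eq hx.1
  obtain ⟨a, b, rfl⟩ := List.length_eq_two.1 hlen
  have curl := congrFun (H.curl_annihilation_signs e) (a, b)
  simp only [wordOp, LinearMap.comp_apply, LinearMap.id_apply, List.append_assoc,
    List.cons_append, List.nil_append, sliceOp_cross, sliceOp_cap, ← mul_assoc]
  simp only [mulVec, dotProduct, ← mul_assoc, ← Finset.sum_mul] at curl ⊢
  rw [curl, Pi.smul_apply, smul_eq_mul]

lemma expectation_curl_cup [Nonempty ι] (H : V.SatisfiesKauffmanRelations z α) {e : Bool}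
    {u v : List Slice} {i : ℕ} {W' W : LinkDiagram}
    (hW' : W'.word = u ++ [cup i, cross e i] ++ v) (hW : W.word = u ++ [cup i] ++ v) :
    V.expectation W' = (bif e then α else α⁻¹) * V.expectation W := by
  refine V.expectation_eq_mul_of_local hW' hW fun n f st hx => ?_
  obtain ⟨l, x, r, rfl, hlen, rfl⟩ := exists_append_eq hx.1
  obtain rfl := List.length_eq_zero_iff.1 hlen
  simp only [wordOp, LinearMap.comp_apply, LinearMap.id_apply, List.nil_append, sliceOp_cup,
    List.append_assoc, sliceOp_cross]
  exact (dotProduct_mulVec _ _ _).trans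
    (by rw [H.curl_creation_signs e, smul_dotProduct, smul_eq_mul])

theorem isKauffmanPolynomial [Nonempty ι] (H : V.SatisfiesKauffmanRelations z α) (hz : z ≠ 0) :
    IsKauffmanPolynomial z α V.expectation where
  regular_isotopy K K' h := by
    induction h with
    | rel _ _ h => exact H.expectation_eq_of_step h
    | refl => rfl
    | symm _ _ _ ih => exact ih.symm
    | trans _ _ _ _ _ ih ih' => exact ih.trans ih'
  skein _ _ _ _ _ _ _ hp hm hinf h0 := H.expectation_skein hp hm hinf h0
  circle_eq := H.expectation_circle hz
  curl_cap _ _ _ _ _ _ hp hm hW := ⟨H.expectation_curl_cap hp hW, H.expectation_curl_cap hm hW⟩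
  curl_cup _ _ _ _ _ _ hp hm hW := ⟨H.expectation_curl_cup hp hW, H.expectation_curl_cup hm hW⟩

end Amplitudes.SatisfiesKauffmanRelations

/-! ### Rotation of the braid relation -/

section ThreeStrands

variable {F ι : Type*} [Field F] [Fintype ι] [DecidableEq ι]

lemma leftOf_mul_rightOf_apply (A B : Matrix (ι × ι) (ι × ι) F) (a b c d e f : ι) :
    (leftOf A * rightOf B) (a, b, c) (d, e, f) = ∑ w, A (a, b) (d, w) * B (w, c) (e, f) := by
  simp [mul_apply, Fintype.sum_prod_type, leftOf_apply, rightOf_apply]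

lemma rightOf_mul_leftOf_apply (A B : Matrix (ι × ι) (ι × ι) F) (a b c d e f : ι) :
    (rightOf A * leftOf B) (a, b, c) (d, e, f) = ∑ w, A (b, c) (w, f) * B (a, w) (d, e) := by
  simp [mul_apply, Fintype.sum_prod_type, leftOf_apply, rightOf_apply]

lemma leftOf_mul_rightOf_mul_leftOf_apply (A B C : Matrix (ι × ι) (ι × ι) F) (a b c d e f : ι) :
    (leftOf A * rightOf B * leftOf C) (a, b, c) (d, e, f) =
      ∑ x, ∑ y, ∑ w, A (a, b) (x, y) * B (y, c) (w, f) * C (x, w) (d, e) := by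
  rw [Matrix.mul_assoc, mul_apply]
  simp [Fintype.sum_prod_type, leftOf_apply, rightOf_mul_leftOf_apply, Finset.mul_sum, mul_assoc]

lemma rightOf_mul_leftOf_mul_rightOf_apply (A B C : Matrix (ι × ι) (ι × ι) F) (a b c d e f : ι) :
    (rightOf A * leftOf B * rightOf C) (a, b, c) (d, e, f) =
      ∑ x, ∑ y, ∑ w, A (b, c) (x, y) * B (a, x) (d, w) * C (w, y) (e, f) := by
  rw [Matrix.mul_assoc, mul_apply]
  simp [Fintype.sum_prod_type, rightOf_apply, leftOf_mul_rightOf_apply, Finset.mul_sum, mul_assoc]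

/-- The difference of the two sides of the braid relation. -/
def braidDefect (B : Matrix (ι × ι) (ι × ι) F) : Matrix (ι × ι × ι) (ι × ι × ι) F :=
  leftOf B * rightOf B * leftOf B - rightOf B * leftOf B * rightOf B

lemma braidDefect_mirror {rv : ι → ι} (hrv : Function.Involutive rv)
    {B : Matrix (ι × ι) (ι × ι) F} (hB : ∀ a b c d, B (rv b, rv a) (rv d, rv c) = B (a, b) (c, d))
    (a b c d e f : ι) :
    braidDefect B (rv c, rv b, rv a) (rv f, rv e, rv d) = -braidDefect B (a, b, c) (d, e, f) := by
  let σ : ι × ι × ι ≃ ι × ι × ι :=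
    ⟨fun p => (rv p.2.2, rv p.2.1, rv p.1), fun p => (rv p.2.2, rv p.2.1, rv p.1),
      fun p => by simp only [hrv _], fun p => by simp only [hrv _]⟩
  have hleft : (leftOf B).submatrix σ σ = rightOf B := by
    ext ⟨a, b, c⟩ ⟨d, e, f⟩
    simp only [submatrix_apply, σ, Equiv.coe_fn_mk, leftOf_apply, rightOf_apply, hB,
      hrv.injective.eq_iff]
  have hright : (rightOf B).submatrix σ σ = leftOf B := by
    ext ⟨a, b, c⟩ ⟨d, e, f⟩
    simp only [submatrix_apply, σ, Equiv.coe_fn_mk, leftOf_apply, rightOf_apply, hB,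
      hrv.injective.eq_iff]
  have hdefect : (braidDefect B).submatrix σ σ = -braidDefect B := by
    simp only [braidDefect, submatrix_sub, Pi.sub_apply, ← submatrix_mul_equiv _ _ σ σ σ, hleft,
      hright, neg_sub]
  exact congrFun (congrFun hdefect (a, b, c)) (d, e, f)

/-- Sliding the third strand, in the state `k`, across the crossing of the other two. -/
lemma braidDefect_eq_zero_of_free {B : Matrix (ι × ι) (ι × ι) F} {k : ι} {χ : ι → F}
    (hB : ∀ x w f, B (x, k) (w, f) = if w = k ∧ f = x then χ x else 0)
    (hχ : ∀ a b c d, B (a, b) (c, d) ≠ 0 → χ a * χ b = χ c * χ d) (a b d e f : ι) :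
    braidDefect B (a, b, k) (d, e, f) = 0 := by
  have hl : (leftOf B * rightOf B * leftOf B) (a, b, k) (d, e, f) =
      if d = k then B (a, b) (e, f) * (χ e * χ f) else 0 := by
    simp [leftOf_mul_rightOf_mul_leftOf_apply, hB, ite_and, mul_comm, mul_left_comm,
      mul_assoc]
  have hr : (rightOf B * leftOf B * rightOf B) (a, b, k) (d, e, f) =
      if d = k then B (a, b) (e, f) * (χ a * χ b) else 0 := by
    simp [rightOf_mul_leftOf_mul_rightOf_apply, hB, ite_and, mul_comm]
  rw [braidDefect, Matrix.sub_apply, hl, hr]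
  by_cases h : B (a, b) (e, f) = 0
  · simp [h]
  · rw [hχ _ _ _ _ h, sub_self]

end ThreeStrands

section CapCup

variable {F ι : Type*} [Field F] [DecidableEq ι]

/-- The amplitudes of a maximum on which the state `a` meets only the state `rv a`, with
amplitude `μ a`. -/
def capAmplitude (rv : ι → ι) (μ : ι → F) (p : ι × ι) : F :=
  if p.2 = rv p.1 then μ p.1 else 0

/-- The amplitudes of the minimum that is inverse to the maximum `capAmplitude rv μ`. -/
def cupAmplitude (rv : ι → ι) (μ : ι → F) (p : ι × ι) : F :=
  if p.2 = rv p.1 then (μ p.2)⁻¹ else 0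

/-- A maximum followed by a minimum. -/
def capCup (rv : ι → ι) (μ : ι → F) : Matrix (ι × ι) (ι × ι) F :=
  vecMulVec (capAmplitude rv μ) (cupAmplitude rv μ)

lemma capCup_apply (rv : ι → ι) (μ : ι → F) (a b c d : ι) :
    capCup rv μ (a, b) (c, d) = if b = rv a then (if d = rv c then μ a / μ d else 0) else 0 := by
  simp only [capCup, vecMulVec_apply, capAmplitude, cupAmplitude]
  split_ifs <;> simp [div_eq_mul_inv]

end CapCup

section CrossingPair

variable {F ι : Type*} [Field F] [Fintype ι] [DecidableEq ι]

/-- Two mutually inverse crossing matrices that are exchanged by a rotation by a right angle, are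
invariant under reflection in a vertical line, and satisfy the skein relation. -/
structure IsCrossingPair (rv : ι → ι) (μ : ι → F) (z : F) (B B' : Matrix (ι × ι) (ι × ι) F) :
    Prop where
  involutive : Function.Involutive rv
  ne_zero : ∀ a, μ a ≠ 0
  cancel : B * B' = 1
  rotate : ∀ a b c d, B (a, b) (c, d) = B' (rv c, a) (d, rv b) * (μ (rv b) / μ (rv c))
  rotate' : ∀ a b c d, B' (a, b) (c, d) = B (rv c, a) (d, rv b) * (μ (rv b) / μ (rv c))
  mirror : ∀ a b c d, B (rv b, rv a) (rv d, rv c) = B (a, b) (c, d)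
  mirror' : ∀ a b c d, B' (rv b, rv a) (rv d, rv c) = B' (a, b) (c, d)
  skein : B - B' = z • (capCup rv μ - 1)

/-- The amplitudes of the link model with crossings `B` and `B'`, where a strand changes its state
by `rv` in a maximum or a minimum. -/
def crossingAmplitudes (rv : ι → ι) (μ : ι → F) (B B' : Matrix (ι × ι) (ι × ι) F) :
    Amplitudes F ι :=
  ⟨cupAmplitude rv μ, capAmplitude rv μ, fun e => bif e then B else B'⟩

namespace IsCrossingPair

variable {rv : ι → ι} {μ : ι → F} {z : F} {B B' : Matrix (ι × ι) (ι × ι) F}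

lemma symm (H : IsCrossingPair rv μ z B B') : IsCrossingPair rv μ (-z) B' B where
  involutive := H.involutive
  ne_zero := H.ne_zero
  cancel := mul_eq_one_comm.1 H.cancel
  rotate := H.rotate'
  rotate' := H.rotate
  mirror := H.mirror'
  mirror' := H.mirror
  skein := by rw [neg_smul, ← H.skein, neg_sub]

lemma rightOf_capCup_mul_leftOf_capCup_apply (H : IsCrossingPair rv μ z B B') (a b c d e f : ι) :
    (rightOf (capCup rv μ) * leftOf (capCup rv μ)) (a, b, c) (d, e, f) =
      if c = rv b then (if e = rv d then (if f = a then μ b / μ e else 0) else 0) else 0 := by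
  have hsum : (rightOf (capCup rv μ) * leftOf (capCup rv μ)) (a, b, c) (d, e, f) =
      capCup rv μ (b, c) (rv a, f) * capCup rv μ (a, rv a) (d, e) := by
    rw [rightOf_mul_leftOf_apply]
    exact Fintype.sum_eq_single _ fun w hw => by simp [capCup_apply, hw]
  rw [hsum, capCup_apply, capCup_apply, H.involutive]
  have := H.ne_zero a
  split_ifs <;> simp_all [div_mul_div_cancel₀]

lemma rightOf_capCup_mul_leftOf (H : IsCrossingPair rv μ z B B') :
    rightOf (capCup rv μ) * leftOf B =
      rightOf (capCup rv μ) * leftOf (capCup rv μ) * rightOf B' := by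
  ext ⟨a, b, c⟩ ⟨d, e, f⟩
  rw [rightOf_mul_leftOf_apply, mul_apply]
  simp only [Fintype.sum_prod_type, H.rightOf_capCup_mul_leftOf_capCup_apply, capCup_apply,
    rightOf_apply]
  by_cases hc : c = rv b
  · have := H.ne_zero f
    simp only [hc, ↓reduceIte, ← H.involutive.eq_iff (x := f), ite_mul, zero_mul,
      Finset.sum_ite_eq, Finset.mem_univ, H.rotate a (rv f), H.involutive f, mul_ite, mul_zero,
      Finset.sum_ite_irrel, Finset.sum_ite_eq', Finset.sum_const_zero]
    field_simp
  · simp [hc]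

lemma rightOf_mul_leftOf_capCup (H : IsCrossingPair rv μ z B B') :
    rightOf B * leftOf (capCup rv μ) =
      leftOf B' * (rightOf (capCup rv μ) * leftOf (capCup rv μ)) := by
  ext ⟨a, b, c⟩ ⟨d, e, f⟩
  rw [rightOf_mul_leftOf_apply, mul_apply]
  simp only [Fintype.sum_prod_type, H.rightOf_capCup_mul_leftOf_capCup_apply, capCup_apply,
    leftOf_apply]
  by_cases hd : e = rv d
  · have := H.ne_zero a
    simp only [hd, ↓reduceIte, mul_ite, mul_zero, Finset.sum_ite_eq', Finset.mem_univ,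
      H.rotate b c (rv a), H.involutive a, ite_mul, zero_mul, ← H.involutive.eq_iff (x := c),
      Finset.sum_ite_irrel, Finset.sum_ite_eq, Finset.sum_const_zero]
    field_simp
  · simp [hd]

/-- Two crossings pass through a minimum, or through a maximum. -/
lemma rightOf_capCup_slide (H : IsCrossingPair rv μ z B B') :
    rightOf (capCup rv μ) * leftOf B * rightOf B =
      leftOf B * rightOf B * leftOf (capCup rv μ) := by
  rw [H.rightOf_capCup_mul_leftOf, Matrix.mul_assoc, ← map_mul, H.symm.cancel, map_one, mul_one,
    Matrix.mul_assoc (leftOf B), H.rightOf_mul_leftOf_capCup, ← Matrix.mul_assoc,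
    ← Matrix.mul_assoc, ← map_mul, H.cancel, map_one, one_mul]

lemma rotate_leftOf_mul_rightOf_mul_leftOf (H : IsCrossingPair rv μ z B B') (a b c d e f : ι) :
    (leftOf B * rightOf B * leftOf B) (a, b, c) (d, e, f) =
      μ (rv c) / μ (rv d) *
        (rightOf B * leftOf B' * rightOf B') (rv d, a, b) (e, f, rv c) := by
  rw [leftOf_mul_rightOf_mul_leftOf_apply, rightOf_mul_leftOf_mul_rightOf_apply]
  simp only [Finset.mul_sum]
  refine Finset.sum_congr rfl fun x _ => Finset.sum_congr rfl fun y _ =>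
    Fintype.sum_equiv H.involutive.toPerm _ _ fun w => ?_
  rw [H.rotate y c w f, H.rotate x w d e, Function.Involutive.coe_toPerm]
  have := H.ne_zero (rv w)
  field_simp

lemma rotate_rightOf_mul_leftOf_mul_rightOf (H : IsCrossingPair rv μ z B B') (a b c d e f : ι) :
    (rightOf B * leftOf B * rightOf B) (a, b, c) (d, e, f) =
      μ (rv c) / μ (rv d) *
        (leftOf B' * rightOf B' * leftOf B) (rv d, a, b) (e, f, rv c) := by
  rw [leftOf_mul_rightOf_mul_leftOf_apply, rightOf_mul_leftOf_mul_rightOf_apply]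
  simp only [Finset.mul_sum, ← Fintype.sum_prod_type']
  refine Fintype.sum_equiv ⟨fun p => (p.2.2, rv p.1, p.2.1), fun p => (rv p.2.1, p.2.2, p.1),
    fun p => by simp only [H.involutive _], fun p => by simp only [H.involutive _]⟩
    _ _ fun ⟨x, y, w⟩ => ?_
  rw [H.rotate b c x y, H.rotate a x d w, Equiv.coe_fn_mk]
  have := H.ne_zero (rv x)
  field_simp

/-- By the skein relation, the mixed braid relation for `B`, `B'`, `B'` is the one for `B'`. -/
lemma mixed_eq_neg_braidDefect (H : IsCrossingPair rv μ z B B') :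
    rightOf B * leftOf B' * rightOf B' - leftOf B' * rightOf B' * leftOf B = -braidDefect B' := by
  rw [eq_add_of_sub_eq H.skein, braidDefect]
  simp only [map_add, map_sub, map_smul, map_one, add_mul, mul_add, sub_mul, mul_sub, one_mul,
    mul_one, smul_mul_assoc, mul_smul_comm, H.symm.rightOf_capCup_slide]
  abel

lemma braidDefect_rotate (H : IsCrossingPair rv μ z B B') (a b c d e f : ι) :
    braidDefect B (a, b, c) (d, e, f) =
      -(μ (rv c) / μ (rv d)) * braidDefect B' (rv d, a, b) (e, f, rv c) := by
  rw [braidDefect, Matrix.sub_apply, H.rotate_leftOf_mul_rightOf_mul_leftOf,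
    H.rotate_rightOf_mul_leftOf_mul_rightOf, ← mul_sub, ← Matrix.sub_apply,
    H.mixed_eq_neg_braidDefect, Matrix.neg_apply, mul_neg, neg_mul]

lemma braidDefect_eq_zero_iff_rotate (H : IsCrossingPair rv μ z B B') {a b c d e f : ι} :
    braidDefect B (a, b, c) (d, e, f) = 0 ↔ braidDefect B' (rv d, a, b) (e, f, rv c) = 0 := by
  rw [H.braidDefect_rotate, neg_mul, neg_eq_zero,
    mul_eq_zero_iff_left (div_ne_zero (H.ne_zero _) (H.ne_zero _))]

lemma braidDefect_eq_zero_iff_mirror (H : IsCrossingPair rv μ z B B') {a b c d e f : ι} :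
    braidDefect B (a, b, c) (d, e, f) = 0 ↔
      braidDefect B (rv c, rv b, rv a) (rv f, rv e, rv d) = 0 := by
  rw [braidDefect_mirror H.involutive H.mirror, neg_eq_zero]

lemma braidDefect_eq_zero_of_first (H : IsCrossingPair rv μ z B B') {k : ι}
    (h : ∀ a b d e f, braidDefect B (a, b, k) (d, e, f) = 0) {a : ι} (ha : a = k ∨ a = rv k)
    (b c d e f : ι) : braidDefect B (a, b, c) (d, e, f) = 0 := by
  rcases ha with rfl | rfl
  · rw [H.braidDefect_eq_zero_iff_rotate, H.symm.braidDefect_eq_zero_iff_rotate]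
    exact h _ _ _ _ _
  · rw [H.braidDefect_eq_zero_iff_mirror, H.involutive]
    exact h _ _ _ _ _

/-- Each of the six outer states can be rotated into the first position. -/
lemma braidDefect_eq_zero_of_third (H : IsCrossingPair rv μ z B B') {k : ι}
    (h : ∀ a b d e f, braidDefect B (a, b, k) (d, e, f) = 0)
    (h' : ∀ a b d e f, braidDefect B' (a, b, rv k) (d, e, f) = 0) {a b c d e f : ι}
    (hk : (a = k ∨ a = rv k) ∨ (b = k ∨ b = rv k) ∨ (c = k ∨ c = rv k) ∨ (d = k ∨ d = rv k) ∨
      (e = k ∨ e = rv k) ∨ (f = k ∨ f = rv k)) :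
    braidDefect B (a, b, c) (d, e, f) = 0 := by
  have rot {a b c d e f} := H.braidDefect_eq_zero_iff_rotate (a := a) (b := b) (c := c) (d := d)
    (e := e) (f := f)
  have rot' {a b c d e f} := H.symm.braidDefect_eq_zero_iff_rotate (a := a) (b := b) (c := c)
    (d := d) (e := e) (f := f)
  have first {x} (hx : x = k ∨ x = rv k) := H.braidDefect_eq_zero_of_first h hx
  have first' {x} (hx : x = k ∨ x = rv k) := H.symm.braidDefect_eq_zero_of_first h' (a := x)
    (by rwa [H.involutive, or_comm])
  have hrv {x} (hx : x = k ∨ x = rv k) : rv x = k ∨ rv x = rv k := by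
    rwa [H.involutive.eq_iff, H.involutive.injective.eq_iff, or_comm]
  rcases hk with hk | hk | hk | hk | hk | hk
  · exact first hk ..
  · rw [rot, rot', rot, rot', rot]
    exact first' (hrv (hrv hk)) ..
  · rw [rot, rot', rot, rot']
    exact first (hrv (hrv hk)) ..
  · rw [rot]
    exact first' (hrv hk) ..
  · rw [rot, rot']
    exact first (hrv hk) ..
  · rw [rot, rot', rot]
    exact first' (hrv hk) ..

lemma sum_capAmplitude_mul_cupAmplitude (H : IsCrossingPair rv μ z B B') (a c : ι) :
    ∑ b, capAmplitude rv μ (a, b) * cupAmplitude rv μ (b, c) = if a = c then 1 else 0 := by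
  rw [Fintype.sum_eq_single (rv a) fun b hb => by simp [capAmplitude, hb]]
  rcases eq_or_ne a c with rfl | h
  · simp [capAmplitude, cupAmplitude, H.involutive a, H.ne_zero a]
  · simp [cupAmplitude, H.involutive a, h, h.symm]

lemma sum_cupAmplitude_mul_capAmplitude (H : IsCrossingPair rv μ z B B') (a c : ι) :
    ∑ b, cupAmplitude rv μ (a, b) * capAmplitude rv μ (b, c) = if a = c then 1 else 0 := by
  rw [Fintype.sum_eq_single (rv a) fun b hb => by simp [cupAmplitude, hb]]
  rcases eq_or_ne a c with rfl | h
  · simp [capAmplitude, cupAmplitude, H.involutive a, H.ne_zero (rv a)]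
  · simp [capAmplitude, H.involutive a, h, h.symm]

lemma sum_mul_capAmplitude (H : IsCrossingPair rv μ z B B') (a b c d : ι) :
    ∑ w, B (a, b) (d, w) * capAmplitude rv μ (w, c) =
      ∑ w, B' (b, c) (w, d) * capAmplitude rv μ (a, w) := by
  have := H.ne_zero a
  simp only [capAmplitude, ← H.involutive.eq_iff (x := c), mul_ite, mul_zero, Finset.sum_ite_eq,
    Finset.mem_univ, ↓reduceIte, Finset.sum_ite_eq', H.rotate' b c (rv a) d, H.involutive a]
  field_simp

lemma sum_cupAmplitude_mul (H : IsCrossingPair rv μ z B B') (a b c d : ι) :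
    ∑ w, cupAmplitude rv μ (a, w) * B (w, b) (c, d) =
      ∑ w, cupAmplitude rv μ (w, d) * B' (b, w) (a, c) := by
  have := H.ne_zero d
  simp only [cupAmplitude, ite_mul, zero_mul, Finset.sum_ite_eq', Finset.mem_univ, ↓reduceIte,
    ← H.involutive.eq_iff (x := d), Finset.sum_ite_eq, H.rotate' b (rv d) a c, H.involutive d]
  field_simp

lemma cupAmplitude_vecMul (H : IsCrossingPair rv μ z B B') (hz : z ≠ 0) {α : F}
    (h : B *ᵥ capAmplitude rv μ = α • capAmplitude rv μ) :
    cupAmplitude rv μ ᵥ* B = α • cupAmplitude rv μ := by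
  have hinv : B * B' = B' * B := by rw [H.cancel, H.symm.cancel]
  have hcomm : B * capCup rv μ = capCup rv μ * B := by
    rw [← sub_sub_self B B', H.skein] at hinv
    simp only [mul_sub, sub_mul, mul_smul_comm, smul_mul_assoc, mul_one, one_mul, sub_right_inj,
      smul_sub, sub_left_inj] at hinv
    exact smul_right_injective _ hz hinv
  funext ⟨c, d⟩
  have hrow := congrFun (congrFun hcomm (c, rv c)) (c, d)
  rw [capCup, mul_vecMulVec, vecMulVec_mul, h, vecMulVec_apply, vecMulVec_apply] at hrow
  have hne : capAmplitude rv μ (c, rv c) ≠ 0 := by simpa [capAmplitude] using H.ne_zero c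
  refine mul_left_cancel₀ hne (hrow.symm.trans ?_)
  simp only [Pi.smul_apply, smul_eq_mul]
  ring

theorem satisfiesKauffmanRelations (H : IsCrossingPair rv μ z B B') (hz : z ≠ 0) {α : F}
    (hbraid : braidDefect B = 0) (hcurl : B *ᵥ capAmplitude rv μ = α • capAmplitude rv μ) :
    (crossingAmplitudes rv μ B B').SatisfiesKauffmanRelations z α where
  cancel := by rintro (_ | _); exacts [H.symm.cancel, H.cancel]
  braid := sub_eq_zero.1 hbraid
  zigzag_left := H.sum_capAmplitude_mul_cupAmplitude
  zigzag_right := H.sum_cupAmplitude_mul_capAmplitude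
  slide_annihilation := by
    rintro (_ | _)
    exacts [H.symm.sum_mul_capAmplitude, H.sum_mul_capAmplitude]
  slide_creation := by
    rintro (_ | _)
    exacts [H.symm.sum_cupAmplitude_mul, H.sum_cupAmplitude_mul]
  skein := H.skein
  curl_annihilation := hcurl
  curl_creation := H.cupAmplitude_vecMul hz hcurl

end IsCrossingPair

end CrossingPair

/-! ### The braiding of labelled states -/

section Entries

variable {F : Type*} [Field F]

/-- The amplitude of the transposition of the states labelled `a` and `b`. -/
def coupling (γ : F) (a b : ℤ) : F :=
  if a = b then (if a = 0 then 1 else γ) else if a + b = 0 then γ⁻¹ else 1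

/-- The amplitudes of the braiding `ℬ` for states labelled symmetrically about `0`, so that
complementary states have opposite labels. -/
def braidEntry (γ : F) (m : ℤ → F) (a b c d : ℤ) : F :=
  (if c = b ∧ d = a then coupling γ a b else 0) -
    (if a < b ∧ c = a ∧ d = b then γ⁻¹ - γ else 0) +
    (if a + b = 0 ∧ c + d = 0 ∧ a < d then (γ⁻¹ - γ) * (m a / m d) else 0)

/-- The diagonal part of the curl of the state labelled `i`. -/
def curlTerm (γ : F) (m : ℤ → F) (i : ℤ) : F :=
  coupling γ i (-i) * (m (-i) / m i) - if i < 0 then γ⁻¹ - γ else 0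

variable {γ : F} {m : ℤ → F}

lemma braidEntry_support {a b c d : ℤ} (h : braidEntry γ m a b c d ≠ 0) :
    (c = b ∧ d = a) ∨ (a < b ∧ c = a ∧ d = b) ∨ (a + b = 0 ∧ c + d = 0 ∧ a < d) := by
  unfold braidEntry at h; grind

lemma braidEntry_mirror (a b c d : ℤ) :
    braidEntry γ m (-b) (-a) (-d) (-c) = braidEntry γ m a b c d := by
  unfold braidEntry coupling; grind (splits := 20)

lemma braidEntry_rotate (hm : ∀ i, m i ≠ 0) (a b c d : ℤ) :
    braidEntry γ m a b c d =
      braidEntry γ⁻¹ (fun i => m (-i)) c (-a) (-d) b * (m (-b) / m (-c)) := by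
  have := hm (-b)
  have := hm (-c)
  unfold braidEntry coupling; grind (splits := 20)

/-- The skein relation: negating the labels and inverting `γ` gives the opposite crossing. -/
lemma braidEntry_sub_braidEntry_neg (hm : ∀ i, m i ≠ 0) (a b c d : ℤ) :
    braidEntry γ m a b c d - braidEntry γ⁻¹ (fun i => m (-i)) (-a) (-b) (-c) (-d) =
      (γ⁻¹ - γ) * ((if a + b = 0 ∧ c + d = 0 then m a / m d else 0) -
        if a = c ∧ b = d then 1 else 0) := by
  have := hm a
  unfold braidEntry coupling; grind (splits := 20)

lemma braidEntry_of_le {k x w f : ℤ} (hx : k ≤ x ∧ x ≤ -k) (hf : k ≤ f ∧ f ≤ -k) :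
    braidEntry γ m x k w f = if w = k ∧ f = x then coupling γ x k else 0 := by
  unfold braidEntry; grind

lemma coupling_mul_coupling_of_braidEntry_ne_zero (hγ : γ ≠ 0) {a b c d : ℤ} (k : ℤ)
    (h : braidEntry γ m a b c d ≠ 0) :
    coupling γ a k * coupling γ b k = coupling γ c k * coupling γ d k := by
  have := braidEntry_support h
  unfold coupling; grind

lemma braidEntry_hecke (hγ : γ ≠ 0) {a b c d : ℤ} (h : a + b ≠ 0) :
    coupling γ a b * braidEntry γ m b a c d -
      (if a < b then (γ⁻¹ - γ) * braidEntry γ m a b c d else 0) =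
      (if a = c ∧ b = d then 1 else 0) - (γ⁻¹ - γ) * braidEntry γ m a b c d := by
  unfold braidEntry coupling; grind (splits := 20)

lemma braidEntry_hecke_complementary (hm : ∀ i, m i ≠ 0) (hγ : γ ≠ 0) (i j : ℤ) :
    coupling γ i (-i) * braidEntry γ m (-i) i (-j) j -
        (if i < -i then (γ⁻¹ - γ) * braidEntry γ m i (-i) (-j) j else 0) +
      ((if i < -j then (γ⁻¹ - γ) * (m i / m (-j)) * coupling γ j (-j) else 0) -
        (if i < j ∧ 0 < j then (γ⁻¹ - γ) * (γ⁻¹ - γ) * (m i / m j) else 0)) =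
      (if i = -j then 1 else 0) - (γ⁻¹ - γ) * braidEntry γ m i (-i) (-j) j +
        (γ⁻¹ - γ) * (m i / m j) * curlTerm γ m (max i (-j)) := by
  have := hm i
  have := hm (-i)
  have := hm j
  have := hm (-j)
  unfold braidEntry curlTerm coupling
  rcases lt_trichotomy i (-j) with h | h | h <;> rcases lt_trichotomy i j with h' | h' | h' <;>
    rcases lt_trichotomy i 0 with hi | hi | hi <;> rcases lt_trichotomy j 0 with hj | hj | hj <;>
    first
    | (exfalso; lia)
    | (subst_vars
       simp (disch := lia) only [if_pos, if_neg, neg_neg, neg_zero, and_true,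
         max_eq_left, max_eq_right] at *
       field_simp
       try ring)

end Entries

section Labelled

variable {F ι : Type*} [Field F]

/-- The braiding `ℬ` of states labelled by integers, with entries `braidEntry`. -/
def braidMatrix (lab : ι → ℤ) (γ : F) (m : ℤ → F) : Matrix (ι × ι) (ι × ι) F :=
  of fun p q => braidEntry γ m (lab p.1) (lab p.2) (lab q.1) (lab q.2)

/-- A labelling of the states by integers for which `rv` negates the labels. -/
structure IsLabelling (lab : ι → ℤ) (rv : ι → ι) : Prop where
  injective : Function.Injective lab
  lab_rv : ∀ a, lab (rv a) = -lab a

/-- In terms of labels, the condition that the amplitudes of a maximum form an eigenvector of the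
braiding with the eigenvalue `α`. -/
def HasCurl [Fintype ι] (lab : ι → ℤ) (γ : F) (m : ℤ → F) (α : F) : Prop :=
  ∀ a, curlTerm γ m (lab a) +
    ∑ x, (if lab a < lab x then (γ⁻¹ - γ) * (m (-lab x) / m (lab x)) else 0) = α

namespace IsLabelling

variable {lab : ι → ℤ} {rv : ι → ι}

lemma involutive (L : IsLabelling lab rv) : Function.Involutive rv := fun a =>
  L.injective (by rw [L.lab_rv, L.lab_rv, neg_neg])

lemma neg (L : IsLabelling lab rv) : IsLabelling (-lab) rv where
  injective := neg_injective.comp L.injective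
  lab_rv a := congrArg Neg.neg (L.lab_rv a)

lemma add_eq_zero_iff (L : IsLabelling lab rv) (a b : ι) : lab a + lab b = 0 ↔ b = rv a := by
  rw [← L.injective.eq_iff, L.lab_rv]
  lia

variable {γ : F} {m : ℤ → F}

lemma braidMatrix_sub_braidMatrix_neg [DecidableEq ι] (L : IsLabelling lab rv) (hm : ∀ i, m i ≠ 0) :
    braidMatrix lab γ m - braidMatrix (-lab) γ⁻¹ (fun i => m (-i)) =
      (γ⁻¹ - γ) • (capCup rv (m ∘ lab) - 1) := by
  ext ⟨a, b⟩ ⟨c, d⟩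
  simp only [braidMatrix, Matrix.sub_apply, Matrix.smul_apply, smul_eq_mul, of_apply,
    capCup_apply, one_apply, Prod.mk.injEq, ← L.injective.eq_iff (a := a) (b := c),
    ← L.injective.eq_iff (a := b) (b := d),
    ← L.add_eq_zero_iff, Function.comp_apply, ← ite_and]
  exact braidEntry_sub_braidEntry_neg hm _ _ _ _

variable [Fintype ι]

lemma sum_lt_max (L : IsLabelling lab rv) {α : F} (hα : HasCurl lab γ m α) (a d : ι) :
    ∑ x, (if lab a < lab x ∧ -lab d < lab x then
      (γ⁻¹ - γ) * (m (-lab x) / m (lab x)) else 0) =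
      α - curlTerm γ m (max (lab a) (-lab d)) := by
  obtain ⟨e, he⟩ : ∃ e, lab e = max (lab a) (-lab d) :=
    (le_total (lab a) (-lab d)).elim (fun h => ⟨rv d, by rw [max_eq_right h, L.lab_rv]⟩)
      fun h => ⟨a, by rw [max_eq_left h]⟩
  simp only [← max_lt_iff, ← he, ← hα e, add_sub_cancel_left]

lemma sum_braidEntry_complementary (L : IsLabelling lab rv) (hm : ∀ i, m i ≠ 0) {α : F}
    (hα : HasCurl lab γ m α) (a d : ι) :
    ∑ x, (if lab a < lab x then (γ⁻¹ - γ) * (m (lab a) / m (lab x)) *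
        braidEntry γ m (-lab x) (lab x) (-lab d) (lab d) else 0) =
      (if lab a < -lab d then
          (γ⁻¹ - γ) * (m (lab a) / m (-lab d)) * coupling γ (lab d) (-lab d) else 0) -
        (if lab a < lab d ∧ 0 < lab d then
          (γ⁻¹ - γ) * (γ⁻¹ - γ) * (m (lab a) / m (lab d)) else 0) +
        (γ⁻¹ - γ) * (m (lab a) / m (lab d)) *
          (α - curlTerm γ m (max (lab a) (-lab d))) := by
  classical
  rw [← L.sum_lt_max hα, Finset.mul_sum]
  have hflip : (if lab a < -lab d then
        (γ⁻¹ - γ) * (m (lab a) / m (-lab d)) * coupling γ (lab d) (-lab d) else 0) =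
      ∑ x, if x = rv d then (if lab a < lab x then
        (γ⁻¹ - γ) * (m (lab a) / m (lab x)) * coupling γ (-lab x) (lab x) else 0) else 0 := by
    simp only [Fintype.sum_ite_eq', L.lab_rv, neg_neg]
  have hdiag : (if lab a < lab d ∧ 0 < lab d then
        (γ⁻¹ - γ) * (γ⁻¹ - γ) * (m (lab a) / m (lab d)) else 0) =
      ∑ x, if x = d then (if lab a < lab x ∧ 0 < lab x then
        (γ⁻¹ - γ) * (γ⁻¹ - γ) * (m (lab a) / m (lab x)) else 0) else 0 := by
    rw [Fintype.sum_ite_eq']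
  rw [hflip, hdiag, ← Finset.sum_sub_distrib, ← Finset.sum_add_distrib]
  refine Finset.sum_congr rfl fun x _ => ?_
  have := hm (lab x)
  have := hm (lab d)
  simp only [braidEntry, ← L.injective.eq_iff (a := x), L.lab_rv]
  grind (splits := 20)

variable [DecidableEq ι]

lemma sum_braidMatrix_mul (L : IsLabelling lab rv) (g : ι × ι → F) (a b : ι) :
    ∑ p, braidMatrix lab γ m (a, b) p * g p =
      coupling γ (lab a) (lab b) * g (b, a) -
        (if lab a < lab b then (γ⁻¹ - γ) * g (a, b) else 0) +
        (if b = rv a then ∑ x, (if lab a < lab x then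
          (γ⁻¹ - γ) * (m (lab a) / m (lab x)) * g (rv x, x) else 0) else 0) := by
  simp only [braidMatrix, of_apply, braidEntry, add_mul, sub_mul, Finset.sum_add_distrib,
    Finset.sum_sub_distrib, L.injective.eq_iff, L.add_eq_zero_iff, ite_mul, zero_mul]
  congr 2
  · rw [Fintype.sum_eq_single (b, a) fun p hp => if_neg (hp ∘ fun h => Prod.ext h.1 h.2),
      if_pos ⟨rfl, rfl⟩]
  · rw [Fintype.sum_eq_single (a, b) fun p hp => if_neg (hp ∘ fun h => Prod.ext h.2.1 h.2.2)]
    simp only [and_true]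
  · by_cases h : b = rv a
    · simp only [h, true_and, if_true, Fintype.sum_prod_type_right]
      refine Finset.sum_congr rfl fun x _ => ?_
      rw [Fintype.sum_eq_single (rv x) fun y hy => if_neg (hy ∘ fun h => ?_)]
      · simp only [L.involutive x, true_and]
      · rw [h.1, L.involutive]
    · simp only [h, false_and, if_false, Finset.sum_const_zero]

lemma braidMatrix_mulVec_capAmplitude (L : IsLabelling lab rv) (hm : ∀ i, m i ≠ 0) {α : F}
    (hα : HasCurl lab γ m α) :
    braidMatrix lab γ m *ᵥ capAmplitude rv (m ∘ lab) = α • capAmplitude rv (m ∘ lab) := by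
  funext ⟨a, b⟩
  rw [mulVec, dotProduct, L.sum_braidMatrix_mul, Pi.smul_apply, smul_eq_mul]
  by_cases h : b = rv a
  · subst h
    have hne := hm (lab a)
    have hneg : lab a < -lab a ↔ lab a < 0 := by lia
    simp only [capAmplitude, L.involutive _, if_true, L.lab_rv, Function.comp_apply, ← hα a,
      curlTerm, add_mul, sub_mul (coupling _ _ _ * _), Finset.sum_mul, ite_mul, zero_mul, hneg]
    congr 2
    · field_simp
    · funext x
      congr 1
      ring
  · have h' : a ≠ rv b := fun h' => h (by rw [h', L.involutive])
    simp only [capAmplitude, if_neg h, if_neg h', mul_zero, ite_self, sub_zero, add_zero]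

/-- On the complement of the image of `capCup` this is the Hecke relation. -/
lemma braidMatrix_mul_self (L : IsLabelling lab rv) (hm : ∀ i, m i ≠ 0) (hγ : γ ≠ 0) {α : F}
    (hα : HasCurl lab γ m α) :
    braidMatrix lab γ m * braidMatrix lab γ m =
      1 - (γ⁻¹ - γ) • braidMatrix lab γ m + ((γ⁻¹ - γ) * α) • capCup rv (m ∘ lab) := by
  ext ⟨a, b⟩ ⟨c, d⟩
  rw [mul_apply, L.sum_braidMatrix_mul fun p => braidMatrix lab γ m p (c, d)]
  simp only [braidMatrix, Matrix.add_apply, Matrix.sub_apply, Matrix.smul_apply, smul_eq_mul,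
    of_apply, capCup_apply, one_apply, Prod.mk.injEq, ← L.injective.eq_iff (a := a) (b := c),
    ← L.injective.eq_iff (a := b) (b := d), Function.comp_apply]
  by_cases hab : b = rv a
  swap
  · rw [if_neg hab, if_neg hab, mul_zero, add_zero, add_zero]
    exact braidEntry_hecke hγ (by rwa [Ne, L.add_eq_zero_iff])
  by_cases hcd : d = rv c
  · have hc : lab c = -lab d := by rw [hcd, L.lab_rv, neg_neg]
    have hiff : (lab a = lab c ∧ lab b = lab d) ↔ lab a = -lab d := by
      rw [hab, L.lab_rv]
      lia
    simp only [if_pos hab, if_pos hcd, hiff]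
    simp only [hab, hc, L.lab_rv, L.sum_braidEntry_complementary hm hα]
    linear_combination braidEntry_hecke_complementary hm hγ (lab a) (lab d)
  · have hb : lab b = -lab a := by rw [hab, L.lab_rv]
    have hcd' : lab c + lab d ≠ 0 := by rwa [Ne, L.add_eq_zero_iff]
    have hzero (i : ℤ) : braidEntry γ m i (-i) (lab c) (lab d) = 0 := by
      by_contra h
      have := braidEntry_support h
      lia
    have hzero' (i : ℤ) : braidEntry γ m (-i) i (lab c) (lab d) = 0 := by
      simpa only [neg_neg] using hzero (-i)
    have hne : ¬(lab a = lab c ∧ lab b = lab d) := by lia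
    simp only [hb, L.lab_rv, hzero, hzero', hcd, mul_zero, ite_self,
      Finset.sum_const_zero]
    rw [if_neg (by rwa [← hb])]
    simp

lemma braidMatrix_mul_braidMatrix_neg (L : IsLabelling lab rv) (hm : ∀ i, m i ≠ 0) (hγ : γ ≠ 0)
    {α : F} (hα : HasCurl lab γ m α) :
    braidMatrix lab γ m * braidMatrix (-lab) γ⁻¹ (fun i => m (-i)) = 1 := by
  have hcurl : braidMatrix lab γ m * capCup rv (m ∘ lab) = α • capCup rv (m ∘ lab) := by
    rw [capCup, mul_vecMulVec, L.braidMatrix_mulVec_capAmplitude hm hα, smul_vecMulVec]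
  rw [← sub_sub_self (braidMatrix lab γ m) (braidMatrix (-lab) _ _),
    L.braidMatrix_sub_braidMatrix_neg hm, mul_sub, L.braidMatrix_mul_self hm hγ hα, mul_smul_comm,
    mul_sub, hcurl, mul_one, smul_sub, smul_smul]
  abel

theorem isCrossingPair (L : IsLabelling lab rv) (hm : ∀ i, m i ≠ 0) (hγ : γ ≠ 0) {α : F}
    (hα : HasCurl lab γ m α) :
    IsCrossingPair rv (m ∘ lab) (γ⁻¹ - γ) (braidMatrix lab γ m)
      (braidMatrix (-lab) γ⁻¹ fun i => m (-i)) where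
  involutive := L.involutive
  ne_zero a := hm _
  cancel := L.braidMatrix_mul_braidMatrix_neg hm hγ hα
  rotate a b c d := by
    simpa only [braidMatrix, of_apply, Pi.neg_apply, Function.comp_apply, L.lab_rv, neg_neg] using
      braidEntry_rotate hm (lab a) (lab b) (lab c) (lab d)
  rotate' a b c d := by
    simpa only [braidMatrix, of_apply, Pi.neg_apply, Function.comp_apply, L.lab_rv, neg_neg,
      inv_inv] using
      braidEntry_rotate (γ := γ⁻¹) (fun i => hm (-i)) (-lab a) (-lab b) (-lab c) (-lab d)
  mirror a b c d := by
    simpa only [braidMatrix, of_apply, L.lab_rv] using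
      braidEntry_mirror (lab a) (lab b) (lab c) (lab d)
  mirror' a b c d := by
    simpa only [braidMatrix, of_apply, Pi.neg_apply, L.lab_rv] using
      braidEntry_mirror (-lab a) (-lab b) (-lab c) (-lab d)
  skein := L.braidMatrix_sub_braidMatrix_neg hm

end IsLabelling

end Labelled

/-! ### The braid relation -/

section Restriction

variable {F ι κ : Type*} [Field F] [Fintype ι] [Fintype κ]

lemma sum_triple_of_injective {e : κ → ι} (he : Function.Injective e) {g : ι → ι → ι → F}
    (hg : ∀ x y w, g x y w ≠ 0 → x ∈ Set.range e ∧ y ∈ Set.range e ∧ w ∈ Set.range e) :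
    ∑ x, ∑ y, ∑ w, g (e x) (e y) (e w) = ∑ x, ∑ y, ∑ w, g x y w := by
  simp only [← Fintype.sum_prod_type']
  refine Fintype.sum_of_injective _ (he.prodMap (he.prodMap he)) _ _ (fun p hp => ?_) fun _ => rfl
  by_contra h
  obtain ⟨⟨x, hx⟩, ⟨y, hy⟩, ⟨w, hw⟩⟩ := hg _ _ _ h
  exact hp ⟨(x, y, w), Prod.ext hx (Prod.ext hy hw)⟩

lemma braidDefect_submatrix [DecidableEq ι] [DecidableEq κ] {B : Matrix (ι × ι) (ι × ι) F}
    {e : κ → ι} (he : Function.Injective e) {a b c d f g : κ}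
    (hleft : ∀ x y w, B (e a, e b) (x, y) * B (y, e c) (w, e g) * B (x, w) (e d, e f) ≠ 0 →
      x ∈ Set.range e ∧ y ∈ Set.range e ∧ w ∈ Set.range e)
    (hright : ∀ x y w, B (e b, e c) (x, y) * B (e a, x) (e d, w) * B (w, y) (e f, e g) ≠ 0 →
      x ∈ Set.range e ∧ y ∈ Set.range e ∧ w ∈ Set.range e) :
    braidDefect (B.submatrix (Prod.map e e) (Prod.map e e)) (a, b, c) (d, f, g) =
      braidDefect B (e a, e b, e c) (e d, e f, e g) := by
  simp only [braidDefect, Matrix.sub_apply, leftOf_mul_rightOf_mul_leftOf_apply,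
    rightOf_mul_leftOf_mul_rightOf_apply, ← sum_triple_of_injective he hleft,
    ← sum_triple_of_injective he hright, submatrix_apply, Prod.map_apply]

end Restriction

namespace IsLabelling

variable {F ι : Type*} [Field F] {lab : ι → ℤ} {rv : ι → ι} {γ : F} {m : ℤ → F}

lemma restrict (L : IsLabelling lab rv) (k : ι) :
    IsLabelling (fun x : {x // lab k < lab x ∧ lab x < -lab k} => lab x) fun x =>
      ⟨rv x, by have := x.2; rw [L.lab_rv]; lia⟩ where
  injective _ _ h := Subtype.ext (L.injective h)
  lab_rv _ := L.lab_rv _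

lemma lab_le_neg (L : IsLabelling lab rv) {k : ι} (hk : ∀ x, lab k ≤ lab x) (x : ι) :
    lab x ≤ -lab k := by
  have := hk (rv x)
  rw [L.lab_rv] at this
  lia

variable [Fintype ι]

lemma hasCurl_restrict (L : IsLabelling lab rv) {α : F} (hα : HasCurl lab γ m α) {k : ι}
    (hk : ∀ x, lab k ≤ lab x) :
    ∃ α', HasCurl (fun x : {x // lab k < lab x ∧ lab x < -lab k} => lab x) γ m α' := by
  refine ⟨α - (γ⁻¹ - γ) * (m (-lab (rv k)) / m (lab (rv k))), fun a => ?_⟩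
  classical
  rw [← hα a, ← Fintype.sum_subtype_add_sum_subtype
    (fun x => lab k < lab x ∧ lab x < -lab k), ← add_assoc, eq_comm, add_sub_assoc, add_eq_left,
    sub_eq_zero]
  have := a.2
  rw [Fintype.sum_eq_single ⟨rv k, by rw [L.lab_rv]; lia⟩ fun x hx => if_neg fun h => ?_]
  · exact if_pos (by rw [L.lab_rv]; lia)
  · have := x.2
    have := L.lab_le_neg hk x
    exact hx (Subtype.ext (L.injective (by rw [L.lab_rv]; lia)))

variable [DecidableEq ι]

lemma braidDefect_eq_zero_of_le (L : IsLabelling lab rv) (hγ : γ ≠ 0) {k : ι}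
    (hk : ∀ x, lab k ≤ lab x) (a b d e f : ι) :
    braidDefect (braidMatrix lab γ m) (a, b, k) (d, e, f) = 0 := by
  refine braidDefect_eq_zero_of_free (χ := fun x => coupling γ (lab x) (lab k)) (fun x w f => ?_)
    (fun _ _ _ _ => coupling_mul_coupling_of_braidEntry_ne_zero hγ _) a b d e f
  simpa only [braidMatrix, of_apply, L.injective.eq_iff] using
    braidEntry_of_le (w := lab w) ⟨hk x, L.lab_le_neg hk x⟩ ⟨hk f, L.lab_le_neg hk f⟩

lemma braidDefect_restrict (L : IsLabelling lab rv) {k : ι} (hk : ∀ x, lab k ≤ lab x)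
    (a b c d e f : {x // lab k < lab x ∧ lab x < -lab k}) :
    braidDefect (braidMatrix (fun x : {x // lab k < lab x ∧ lab x < -lab k} => lab x) γ m)
      (a, b, c) (d, e, f) = braidDefect (braidMatrix lab γ m) (a.1, b.1, c.1) (d.1, e.1, f.1) := by
  have hrv (x : ι) : lab k ≤ lab x ∧ lab x ≤ -lab k := ⟨hk x, L.lab_le_neg hk x⟩
  have ha := a.2; have hb := b.2; have hc := c.2; have hd := d.2; have hf := f.2
  refine braidDefect_submatrix (B := braidMatrix lab γ m) Subtype.val_injective
    (fun x y w h => ?_) fun x y w h => ?_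
  all_goals
    have h₁ := braidEntry_support (left_ne_zero_of_mul (left_ne_zero_of_mul h))
    have h₂ := braidEntry_support (right_ne_zero_of_mul (left_ne_zero_of_mul h))
    have hx := hrv x
    have hy := hrv y
    have hw := hrv w
    simp only [Subtype.range_coe_subtype, Set.mem_ofPred_eq]
    lia

lemma braidDefect_eq_zero_of_extreme (L : IsLabelling lab rv) (hm : ∀ i, m i ≠ 0) (hγ : γ ≠ 0)
    {α : F} (hα : HasCurl lab γ m α) {k : ι} (hk : ∀ x, lab k ≤ lab x) {a b c d e f : ι}
    (hex : (a = k ∨ a = rv k) ∨ (b = k ∨ b = rv k) ∨ (c = k ∨ c = rv k) ∨ (d = k ∨ d = rv k) ∨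
      (e = k ∨ e = rv k) ∨ (f = k ∨ f = rv k)) :
    braidDefect (braidMatrix lab γ m) (a, b, c) (d, e, f) = 0 := by
  refine (L.isCrossingPair hm hγ hα).braidDefect_eq_zero_of_third
    (L.braidDefect_eq_zero_of_le hγ hk)
    (L.neg.braidDefect_eq_zero_of_le (inv_ne_zero hγ) fun x => ?_) hex
  rw [Pi.neg_apply, Pi.neg_apply, L.lab_rv, neg_neg]
  exact le_neg_of_le_neg (L.lab_le_neg hk x)

/-- Induction on the number of states, removing the two extreme ones. -/
theorem braidDefect_eq_zero (L : IsLabelling lab rv) (hm : ∀ i, m i ≠ 0) (hγ : γ ≠ 0) {α : F}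
    (hα : HasCurl lab γ m α) : braidDefect (braidMatrix lab γ m) = 0 := by
  induction hn : Fintype.card ι using Nat.strong_induction_on generalizing ι α with
  | _ n ih =>
  subst hn
  ext ⟨a, b, c⟩ ⟨d, e, f⟩
  obtain ⟨k, -, hk⟩ := Finset.exists_min_image Finset.univ lab ⟨a, Finset.mem_univ a⟩
  replace hk (x : ι) : lab k ≤ lab x := hk x (Finset.mem_univ x)
  by_cases hex : (a = k ∨ a = rv k) ∨ (b = k ∨ b = rv k) ∨ (c = k ∨ c = rv k) ∨
      (d = k ∨ d = rv k) ∨ (e = k ∨ e = rv k) ∨ (f = k ∨ f = rv k)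
  · exact L.braidDefect_eq_zero_of_extreme hm hγ hα hk hex
  have inner {x : ι} (hx : ¬x = k ∧ ¬x = rv k) : lab k < lab x ∧ lab x < -lab k := by
    rw [← L.injective.eq_iff, ← L.injective.eq_iff, L.lab_rv] at hx
    have h₁ := hk x
    have h₂ := L.lab_le_neg hk x
    lia
  simp only [not_or] at hex
  obtain ⟨ha, hb, hc, hd, he, hf⟩ := hex
  obtain ⟨α', hα'⟩ := L.hasCurl_restrict hα hk
  have hcard : Fintype.card {x // lab k < lab x ∧ lab x < -lab k} < Fintype.card ι :=
    Fintype.card_subtype_lt (x := k) fun h => h.1.false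
  rw [← L.braidDefect_restrict hk ⟨a, inner ha⟩ ⟨b, inner hb⟩ ⟨c, inner hc⟩ ⟨d, inner hd⟩
    ⟨e, inner he⟩ ⟨f, inner hf⟩, ih _ hcard (L.restrict k) hα' rfl, Matrix.zero_apply,
    Matrix.zero_apply]

end IsLabelling

/-! ### The classical series -/

namespace IsCrossingPair

variable {F ι : Type*} [Field F] [Fintype ι] [DecidableEq ι] [Nonempty ι] {rv : ι → ι} {μ : ι → F}
  {z α : F} {B B' : Matrix (ι × ι) (ι × ι) F}

theorem isKauffmanPolynomial_vacuumExpectation (H : IsCrossingPair rv μ z B B') (hz : z ≠ 0)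
    (hbraid : braidDefect B = 0) (hcurl : B *ᵥ capAmplitude rv μ = α • capAmplitude rv μ) :
    IsUnit B ∧ IsUnit (of (Function.curry (capAmplitude rv μ))) ∧
      IsKauffmanPolynomial z α
        (vacuumExpectation B (of (Function.curry (capAmplitude rv μ)))) := by
  have hM : of (Function.curry (capAmplitude rv μ)) *
      of (Function.curry (cupAmplitude rv μ)) = 1 := by
    ext a c
    exact (H.sum_capAmplitude_mul_cupAmplitude a c).trans (one_apply ..).symm
  refine ⟨.of_mul_eq_one _ H.cancel, .of_mul_eq_one _ hM, ?_⟩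
  rw [Amplitudes.vacuumExpectation_eq_expectation, inv_eq_right_inv hM, inv_eq_right_inv H.cancel]
  exact (H.satisfiesKauffmanRelations hz hbraid hcurl).isKauffmanPolynomial hz

end IsCrossingPair

section Series

variable {F : Type*} [Field F] {N : ℕ}

/-- The label of the `a`-th of `N` states. -/
def label (N : ℕ) (a : Fin N) : ℤ := 2 * a - N + 1

lemma isLabelling_label (N : ℕ) : IsLabelling (label N) Fin.rev where
  injective a b h := by
    simp only [label] at h
    omega
  lab_rv a := by
    simp only [label, Fin.val_rev]
    omega

lemma braiding_eq_braidMatrix {γ : F} {β : ℕ → ℕ → F} {m : ℤ → F}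
    (hβ : ∀ a b : Fin N, a < b → β a b = (γ⁻¹ - γ) * (m (label N a) / m (label N b)) -
      if a.val + b.val + 1 = N then γ⁻¹ - γ else 0) :
    braiding N γ β = braidMatrix (label N) γ m := by
  ext ⟨a, b⟩ ⟨c, d⟩
  have hadd (x y : Fin N) : label N x + label N y = 0 ↔ x.val + y.val + 1 = N := by
    simp only [label]; omega
  have hlt (x y : Fin N) : label N x < label N y ↔ x.val < y.val := by simp only [label]; omega
  have hdiag : a = b → (label N a = 0 ↔ a.val + b.val + 1 = N) := by
    rintro rfl; simp only [label]; omega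
  have hβ := hβ a d
  simp only [braiding, braidMatrix, of_apply, braidEntry, coupling, hadd, hlt, Fin.lt_def,
    (isLabelling_label N).injective.eq_iff, Fin.ext_iff] at hβ hdiag ⊢
  grind (splits := 20)

lemma smul_antidiagonal {t : F} {μ : ℕ → F} {m : ℤ → F}
    (hμ : ∀ a : Fin N, t * μ a = m (label N a)) :
    t • antidiagonal N μ = of (Function.curry (capAmplitude Fin.rev (m ∘ label N))) := by
  ext a b
  have : b = a.rev ↔ a.val + b.val + 1 = N := by
    rw [Fin.ext_iff, Fin.val_rev]
    omega
  simp only [Matrix.smul_apply, antidiagonal, capAmplitude, of_apply, Function.curry_apply, this,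
    smul_eq_mul, mul_ite, mul_zero, hμ, Function.comp_apply]

/-- The ratios of the weights `m` of opposite labels in the orthogonal (`ε = 1`) and symplectic
(`ε = -1`) series. -/
def IsSeriesWeight (ε : ℤ) (p : F) (m : ℤ → F) : Prop :=
  ∀ i ≠ 0, m (-i) / m i = ε * p ^ (i - ε * i.sign)

section Curl

variable {ε : ℤ} {p : F} {m : ℤ → F}

lemma curlTerm_zero (hm : m 0 ≠ 0) (γ : F) : curlTerm γ m 0 = 1 := by
  simp [curlTerm, coupling, hm]

lemma curlTerm_of_neg (hm : IsSeriesWeight ε p m) (hp : p ≠ 0) {i : ℤ} (hi : i < 0) :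
    curlTerm p⁻¹ m i = ε * p ^ (i + ε + 1) - (p - p⁻¹) := by
  have hne : i ≠ -i := by lia
  simp only [curlTerm, coupling, hm i hi.ne, Int.sign_eq_neg_one_of_neg hi, if_pos hi,
    if_neg hne, add_neg_cancel, if_true, inv_inv, zpow_add_one₀ hp, mul_neg_one, sub_neg_eq_add]
  ring

lemma curlTerm_of_pos (hm : IsSeriesWeight ε p m) (hp : p ≠ 0) {i : ℤ} (hi : 0 < i) :
    curlTerm p⁻¹ m i = ε * p ^ (i - ε + 1) := by
  have hne : i ≠ -i := by lia
  simp only [curlTerm, coupling, hm i hi.ne', Int.sign_eq_one_of_pos hi, if_neg hi.not_gt,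
    if_neg hne, add_neg_cancel, if_true, inv_inv, zpow_add_one₀ hp, mul_one]
  ring

lemma zpow_add_sub_inv_mul_zpow (hp : p ≠ 0) (k : ℤ) :
    p ^ k + (p - p⁻¹) * p ^ (k + 1) = p ^ (k + 2) := by
  rw [zpow_add₀ hp, zpow_add₀ hp]
  field_simp
  norm_cast
  ring

lemma curlTerm_add_two (hε : ε = 1 ∨ ε = -1) (hm : IsSeriesWeight ε p m) (hp : p ≠ 0)
    (hm₀ : m 0 ≠ 0) {i : ℤ} (hi : ε = 1 ∨ Odd i) :
    curlTerm p⁻¹ m i + (p - p⁻¹) * (m (-(i + 2)) / m (i + 2)) = curlTerm p⁻¹ m (i + 2) := by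
  rcases lt_trichotomy (i + 2) 0 with h | h | h
  · rw [curlTerm_of_neg hm hp h, curlTerm_of_neg hm hp (by omega), hm _ h.ne,
      Int.sign_eq_neg_one_of_neg h]
    rw [show i + 2 - ε * -1 = i + ε + 1 + 1 by ring, show i + 2 + ε + 1 = i + ε + 1 + 2 by ring,
      ← zpow_add_sub_inv_mul_zpow hp]
    ring
  · obtain rfl : i = -2 := by omega
    obtain rfl : ε = 1 := hi.resolve_right (by decide)
    rw [curlTerm_of_neg hm hp (by decide), h, curlTerm_zero hm₀]
    simp [hm₀]
  rcases lt_trichotomy i 0 with h' | rfl | h'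
  · obtain rfl : i = -1 := by omega
    rw [curlTerm_of_neg hm hp h', curlTerm_of_pos hm hp h, hm _ h.ne']
    rcases hε with rfl | rfl
    · norm_num
    · norm_num
      field_simp
      ring
  · obtain rfl : ε = 1 := hi.resolve_right (by decide)
    rw [curlTerm_zero hm₀, curlTerm_of_pos hm hp h, hm _ h.ne', Int.sign_eq_one_of_pos h]
    norm_num
    field_simp
    ring
  · rw [curlTerm_of_pos hm hp h, curlTerm_of_pos hm hp h', hm _ h.ne', Int.sign_eq_one_of_pos h]
    rw [show i + 2 - ε * 1 = i - ε + 1 + 1 by ring, show i + 2 - ε + 1 = i - ε + 1 + 2 by ring,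
      ← zpow_add_sub_inv_mul_zpow hp]
    ring

lemma add_sum_ite_lt {A : Type*} [AddCommMonoid A] {u v : ℕ → A}
    (h : ∀ a, u a + v (a + 1) = u (a + 1)) (a : Fin N) :
    u a + ∑ x : Fin N, (if a < x then v x else 0) = u (N - 1) := by
  induction N with
  | zero => exact a.elim0
  | succ n ih =>
    rw [Fin.sum_univ_castSucc]
    cases a using Fin.lastCases with
    | last => simp [(Fin.castSucc_lt_last _).not_gt]
    | cast i =>
      have htop := h (n - 1)
      rw [Nat.sub_add_cancel i.pos, ← ih i] at htop
      simpa [Fin.castSucc_lt_last, add_assoc] using htop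

lemma IsSeriesWeight.curlTerm_top (hm : IsSeriesWeight ε p m) (hε : ε = 1 ∨ ε = -1 ∧ Even N)
    (hp : p ≠ 0) (hm₀ : m 0 ≠ 0) (hN : 0 < N) :
    curlTerm p⁻¹ m (N - 1) = ε * p ^ (N - ε) := by
  rcases (Nat.succ_le_of_lt hN).eq_or_lt with rfl | h
  · obtain rfl : ε = 1 := hε.resolve_right fun h => by simpa using h.2
    simp [curlTerm_zero hm₀]
  · rw [curlTerm_of_pos hm hp (by omega)]
    congr 2
    ring

lemma IsSeriesWeight.hasCurl (hm : IsSeriesWeight ε p m) (hε : ε = 1 ∨ ε = -1 ∧ Even N)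
    (hp : p ≠ 0) (hm₀ : m 0 ≠ 0) : HasCurl (label N) p⁻¹ m (ε * p ^ (N - ε)) := by
  intro a
  have hsum := add_sum_ite_lt (u := fun b => curlTerm p⁻¹ m (2 * b - N + 1))
    (v := fun b => (p - p⁻¹) * (m (-(2 * b - N + 1)) / m (2 * b - N + 1))) (fun b => ?_) a
  · have hlt (x : Fin N) : label N a < label N x ↔ a < x := by simp only [label]; omega
    have htop : (N - 1 : ℤ) = 2 * (N - 1 : ℕ) - N + 1 := by
      have := a.pos
      omega
    simp only [hlt, inv_inv]
    rw [← hm.curlTerm_top hε hp hm₀ a.pos, htop]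
    exact hsum
  · have h := curlTerm_add_two (hε.imp_right And.left) hm hp hm₀ (i := 2 * b - N + 1)
      (hε.imp_right fun h => by have := h.2; grind)
    rw [show (2 * (b + 1 : ℕ) - N + 1 : ℤ) = 2 * b - N + 1 + 2 by push_cast; ring]
    exact h

theorem IsSeriesWeight.isKauffmanPolynomial (hw : IsSeriesWeight ε p m)
    (hε : ε = 1 ∨ ε = -1 ∧ Even N) (hN : 0 < N) (hm : ∀ i, m i ≠ 0) (hz : p - p⁻¹ ≠ 0)
    {t : F} {β : ℕ → ℕ → F} {μ : ℕ → F}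
    (hβ : ∀ a b : Fin N, a < b → β a b = (p - p⁻¹) * (m (label N a) / m (label N b)) -
      if a.val + b.val + 1 = N then p - p⁻¹ else 0)
    (hμ : ∀ a : Fin N, t * μ a = m (label N a)) :
    IsUnit (braiding N p⁻¹ β) ∧ IsUnit (t • antidiagonal N μ) ∧
      IsKauffmanPolynomial (p - p⁻¹) (ε * p ^ (N - ε))
        (vacuumExpectation (braiding N p⁻¹ β) (t • antidiagonal N μ)) := by
  have hp : p ≠ 0 := by
    rintro rfl
    simp at hz
  have := Fin.pos_iff_nonempty.1 hN
  have L := isLabelling_label N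
  have hcurl := hw.hasCurl hε hp (hm 0)
  have H := L.isCrossingPair hm (inv_ne_zero hp) hcurl
  rw [inv_inv] at H
  rw [braiding_eq_braidMatrix (by simpa only [inv_inv] using hβ), smul_antidiagonal hμ]
  exact H.isKauffmanPolynomial_vacuumExpectation hz
    (L.braidDefect_eq_zero hm (inv_ne_zero hp) hcurl) (L.braidMatrix_mulVec_capAmplitude hm hcurl)

end Curl

section Orthogonal

variable {s t : F}

/-- The amplitudes of a maximum for `B_n` and `D_n`, as a function of the label. -/
def orthogonalWeight (s t : F) (i : ℤ) : F :=
  t * s ^ (i.sign - i)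

lemma orthogonalWeight_ne_zero (hs : s ≠ 0) (ht : t ≠ 0) (i : ℤ) : orthogonalWeight s t i ≠ 0 :=
  mul_ne_zero ht (zpow_ne_zero _ hs)

lemma orthogonalWeight_div (hs : s ≠ 0) (ht : t ≠ 0) (i j : ℤ) :
    orthogonalWeight s t i / orthogonalWeight s t j = s ^ (j - i + i.sign - j.sign) := by
  rw [orthogonalWeight, orthogonalWeight, mul_div_mul_left _ _ ht, ← zpow_sub₀ hs]
  congr 1
  ring

lemma isSeriesWeight_orthogonalWeight (hs : s ≠ 0) (ht : t ≠ 0) :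
    IsSeriesWeight 1 (s ^ 2) (orthogonalWeight s t) := by
  intro i _
  rw [orthogonalWeight_div hs ht, ← zpow_natCast, ← _root_.zpow_mul, Int.sign_neg, Int.cast_one,
    one_mul]
  congr 1
  push_cast
  ring

lemma sign_sub_sign_of_lt {i j : ℤ} (h : i < j) :
    i.sign - j.sign = if 0 < i * j then 0 else if i * j = 0 then -1 else -2 := by
  rcases lt_trichotomy i 0 with hi | rfl | hi <;> rcases lt_trichotomy j 0 with hj | rfl | hj
  · simp [mul_pos_of_neg_of_neg hi hj, Int.sign_eq_neg_one_of_neg, hi, hj]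
  · simp [Int.sign_eq_neg_one_of_neg hi]
  · have hij := mul_neg_of_neg_of_pos hi hj
    simp [hij.not_gt, hi.ne, hj.ne', Int.sign_eq_neg_one_of_neg hi, Int.sign_eq_one_of_pos hj]
  · omega
  · omega
  · simp [Int.sign_eq_one_of_pos hj]
  · omega
  · omega
  · simp [mul_pos hi hj, Int.sign_eq_one_of_pos, hi, hj]

lemma betaB_eq (hs : s ≠ 0) (ht : t ≠ 0) (n : ℕ) {a b : Fin (2 * n + 1)} (hab : a < b) :
    betaB n s a b = (s ^ 2 - (s ^ 2)⁻¹) * (orthogonalWeight s t (label (2 * n + 1) a) /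
      orthogonalWeight s t (label (2 * n + 1) b)) -
      if a.val + b.val + 1 = 2 * n + 1 then s ^ 2 - (s ^ 2)⁻¹ else 0 := by
  have hlabel (c : Fin (2 * n + 1)) : label (2 * n + 1) c = 2 * (c - n) := by
    simp only [label]
    push_cast
    ring
  have hδ : a.val + b.val = 2 * n → ((a : ℤ) - n) * (b - n) < 0 := fun h => by
    rw [show (b : ℤ) - n = -(a - n) by omega, mul_neg, neg_lt_zero]
    exact mul_self_pos.2 (by omega)
  rw [orthogonalWeight_div hs ht, hlabel, hlabel, Int.sign_mul, Int.sign_mul, add_sub_assoc,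
    show Int.sign 2 = 1 from rfl, one_mul, one_mul, sign_sub_sign_of_lt (by omega)]
  simp only [betaB]
  split_ifs <;> first | omega | ring_nf

lemma betaD_eq (hs : s ≠ 0) (ht : t ≠ 0) (n : ℕ) {a b : Fin (2 * n)} (hab : a < b) :
    betaD n s a b = (s ^ 2 - (s ^ 2)⁻¹) * (orthogonalWeight s t (label (2 * n) a) /
      orthogonalWeight s t (label (2 * n) b)) -
      if a.val + b.val + 1 = 2 * n then s ^ 2 - (s ^ 2)⁻¹ else 0 := by
  have hlabel (c : Fin (2 * n)) : label (2 * n) c = 2 * c - 2 * n + 1 := by simp [label]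
  have hne (c : Fin (2 * n)) : (2 * c - 2 * n + 1 : ℤ) ≠ 0 := by omega
  have hδ : a.val + b.val + 1 = 2 * n →
      (2 * (a : ℤ) - 2 * n + 1) * (2 * b - 2 * n + 1) < 0 := fun h => by
    rw [show (2 * b - 2 * n + 1 : ℤ) = -(2 * a - 2 * n + 1) by omega, mul_neg, neg_lt_zero]
    exact mul_self_pos.2 (hne a)
  rw [orthogonalWeight_div hs ht, hlabel, hlabel, add_sub_assoc, sign_sub_sign_of_lt (by omega),
    if_neg (mul_ne_zero (hne a) (hne b))]
  simp only [betaD]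
  split_ifs <;> first | omega | ring_nf

theorem isKauffmanPolynomial_braidingB (ht : t ≠ 0) (hz : s ^ 2 - (s ^ 2)⁻¹ ≠ 0) (n : ℕ) :
    IsUnit (braidingB n s) ∧ IsUnit (t • fusionB n s) ∧
      IsKauffmanPolynomial (s ^ 2 - (s ^ 2)⁻¹) ((s ^ 4) ^ n)
        (vacuumExpectation (braidingB n s) (t • fusionB n s)) := by
  have hs : s ≠ 0 := by
    rintro rfl
    simp at hz
  have hα : ((1 : ℤ) : F) * (s ^ 2) ^ (((2 * n + 1 : ℕ) : ℤ) - 1) = (s ^ 4) ^ n := by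
    rw [Nat.cast_succ, add_sub_cancel_right, zpow_natCast, Int.cast_one]
    ring
  rw [← hα]
  refine (isSeriesWeight_orthogonalWeight hs ht).isKauffmanPolynomial (.inl rfl) (by omega)
    (orthogonalWeight_ne_zero hs ht) hz (fun a b => betaB_eq hs ht n) fun a => ?_
  simp only [orthogonalWeight, label]
  push_cast
  rcases lt_trichotomy a.val n with h | h | h <;>
    simp (disch := omega) only [if_pos, if_neg, Int.sign_eq_neg_one_of_neg, Int.sign_eq_one_of_pos]
  · ring_nf
  · simp [h]
  · ring_nf

theorem isKauffmanPolynomial_braidingD (ht : t ≠ 0) (hz : s ^ 2 - (s ^ 2)⁻¹ ≠ 0) {n : ℕ}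
    (hn : 1 ≤ n) :
    IsUnit (braidingD n s) ∧ IsUnit (t • fusionD n s) ∧
      IsKauffmanPolynomial (s ^ 2 - (s ^ 2)⁻¹) ((s ^ 2) ^ (2 * n - 1))
        (vacuumExpectation (braidingD n s) (t • fusionD n s)) := by
  have hs : s ≠ 0 := by
    rintro rfl
    simp at hz
  have hα : ((1 : ℤ) : F) * (s ^ 2) ^ (((2 * n : ℕ) : ℤ) - 1) = (s ^ 2) ^ (2 * n - 1) := by
    rw [Int.cast_one, one_mul, ← Nat.cast_pred (by omega), zpow_natCast]
  rw [← hα]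
  refine (isSeriesWeight_orthogonalWeight hs ht).isKauffmanPolynomial (.inl rfl) (by omega)
    (orthogonalWeight_ne_zero hs ht) hz (fun a b => betaD_eq hs ht n) fun a => ?_
  simp only [orthogonalWeight, label]
  push_cast
  rcases lt_or_ge a.val n with h | h <;>
    simp (disch := omega) only [if_pos, if_neg, Int.sign_eq_neg_one_of_neg, Int.sign_eq_one_of_pos]
  · ring_nf
  · ring_nf

end Orthogonal

section Symplectic

variable {I s t : F}

/-- The amplitudes of a maximum for `C_n`, as a function of the label. -/
def symplecticWeight (I s t : F) (i : ℤ) : F :=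
  t * if i < 0 then -I * s ^ (-(i / 2)) else I * s ^ (-(i / 2) - 1)

lemma symplecticWeight_ne_zero (hI : I ≠ 0) (hs : s ≠ 0) (ht : t ≠ 0) (i : ℤ) :
    symplecticWeight I s t i ≠ 0 := by
  unfold symplecticWeight
  split_ifs <;> simp [hI, hs, ht, zpow_ne_zero]

lemma isSeriesWeight_symplecticWeight (hI : I ≠ 0) (hs : s ≠ 0) (ht : t ≠ 0) :
    IsSeriesWeight (-1) s (symplecticWeight I s t) := by
  intro i hi
  rw [div_eq_iff (symplecticWeight_ne_zero hI hs ht i)]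
  rcases hi.lt_or_gt with h | h
  · simp (disch := omega) only [symplecticWeight, if_pos, if_neg, Int.sign_eq_neg_one_of_neg]
    rw [show -(-i / 2) - 1 = (i - 1) + -(i / 2) by omega, zpow_add₀ hs]
    norm_num
    ring
  · simp (disch := omega) only [symplecticWeight, if_pos, if_neg, Int.sign_eq_one_of_pos]
    rw [show -(-i / 2) = (i + 1) + (-(i / 2) - 1) by omega, zpow_add₀ hs]
    norm_num
    ring

lemma betaC_eq (hI : I ≠ 0) (hs : s ≠ 0) (ht : t ≠ 0) (n : ℕ) {a b : Fin (2 * n)} (hab : a < b) :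
    betaC n s a b = (s - s⁻¹) * (symplecticWeight I s t (label (2 * n) a) /
      symplecticWeight I s t (label (2 * n) b)) -
      if a.val + b.val + 1 = 2 * n then s - s⁻¹ else 0 := by
  have hlabel (c : Fin (2 * n)) : label (2 * n) c = 2 * c - 2 * n + 1 := by simp [label]
  have hhalf (c : Fin (2 * n)) : (2 * c - 2 * n + 1 : ℤ) / 2 = c - n := by omega
  have := zpow_ne_zero (-((b : ℤ) - n)) hs
  have := zpow_ne_zero (-((b : ℤ) - n) - 1) hs
  simp only [betaC, symplecticWeight, hlabel, hhalf, mul_div_mul_left _ _ ht]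
  rcases lt_or_ge b.val n with hb | hb
  · rw [if_pos (mul_pos_of_neg_of_neg (by omega) (by omega)),
      show -((a : ℤ) - b) = -(a - n) - -(b - n) by ring, zpow_sub₀ hs]
    simp (disch := omega) only [if_pos, if_neg, sub_zero]
    field_simp
  rcases lt_or_ge a.val n with ha | ha
  · rw [if_neg (mul_neg_of_neg_of_pos (by omega) (by omega)).not_gt,
      show -((a : ℤ) - b - 1) = -(a - n) - (-(b - n) - 1) by ring, zpow_sub₀ hs]
    simp (disch := omega) only [if_pos, if_neg]
    split_ifs <;> field_simp <;> ring
  · rw [if_pos (mul_pos (by omega) (by omega)),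
      show -((a : ℤ) - b) = (-(a - n) - 1) - (-(b - n) - 1) by ring, zpow_sub₀ hs]
    simp (disch := omega) only [if_neg, sub_zero]
    field_simp

theorem isKauffmanPolynomial_braidingC (hI : I ≠ 0) (ht : t ≠ 0) (hz : s - s⁻¹ ≠ 0) {n : ℕ}
    (hn : 1 ≤ n) :
    IsUnit (braidingC n s) ∧ IsUnit (t • fusionC n I s) ∧
      IsKauffmanPolynomial (s - s⁻¹) (-s ^ (2 * n + 1))
        (vacuumExpectation (braidingC n s) (t • fusionC n I s)) := by
  have hs : s ≠ 0 := by
    rintro rfl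
    simp at hz
  have hα : ((-1 : ℤ) : F) * s ^ (((2 * n : ℕ) : ℤ) - -1) = -s ^ (2 * n + 1) := by
    rw [sub_neg_eq_add, ← Nat.cast_succ, zpow_natCast, Int.cast_neg, Int.cast_one, neg_one_mul]
  rw [← hα]
  refine (isSeriesWeight_symplecticWeight hI hs ht).isKauffmanPolynomial
    (.inr ⟨rfl, even_two_mul n⟩) (by omega) (symplecticWeight_ne_zero hI hs ht) hz
    (fun a b => betaC_eq hI hs ht n) fun a => ?_
  have hhalf : (2 * a - (2 * n : ℕ) + 1 : ℤ) / 2 = a - n := by omega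
  simp only [symplecticWeight, label, hhalf, neg_sub]
  rcases lt_or_ge a.val n with h | h <;> simp (disch := omega) only [if_pos, if_neg]

end Symplectic

end Series

lemma sub_inv_ne_zero {F : Type*} [Field F] {x : F} (hx : x ≠ 0) (h : x ^ 2 ≠ 1) :
    x - x⁻¹ ≠ 0 := by
  rwa [sub_ne_zero, ne_eq, ← mul_eq_one_iff_eq_inv₀ hx, ← pow_two]

end LinkSum

theorem mainTheorem1 {F : Type*} [Field F] (n : ℕ) (hn : 1 ≤ n) (q s : F) (hs : s ^ 4 = q)
    (hq : q ≠ 0) (t : F) (ht : t ≠ 0) :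
    (q ≠ 1 →
      IsUnit (LinkSum.braidingB n s) ∧ IsUnit (t • LinkSum.fusionB n s) ∧
      LinkSum.IsKauffmanPolynomial (s ^ 2 - (s ^ 2)⁻¹) (q ^ n)
        (LinkSum.vacuumExpectation (LinkSum.braidingB n s) (t • LinkSum.fusionB n s))) ∧
    (∀ I : F, I ^ 2 = -1 → s ^ 2 ≠ 1 →
      IsUnit (LinkSum.braidingC n s) ∧ IsUnit (t • LinkSum.fusionC n I s) ∧
      LinkSum.IsKauffmanPolynomial (s - s⁻¹) (-s ^ (2 * n + 1))
        (LinkSum.vacuumExpectation (LinkSum.braidingC n s) (t • LinkSum.fusionC n I s))) ∧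
    (q ≠ 1 →
      IsUnit (LinkSum.braidingD n s) ∧ IsUnit (t • LinkSum.fusionD n s) ∧
      LinkSum.IsKauffmanPolynomial (s ^ 2 - (s ^ 2)⁻¹) ((s ^ 2) ^ (2 * n - 1))
        (LinkSum.vacuumExpectation (LinkSum.braidingD n s) (t • LinkSum.fusionD n s))) := by
  subst hs
  have hs : s ≠ 0 := by
    rintro rfl
    simp at hq
  have hz (h : s ^ 4 ≠ 1) : s ^ 2 - (s ^ 2)⁻¹ ≠ 0 :=
    LinkSum.sub_inv_ne_zero (pow_ne_zero 2 hs) (by rwa [← pow_mul])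
  refine ⟨fun h => LinkSum.isKauffmanPolynomial_braidingB ht (hz h) n, fun I hI h => ?_,
    fun h => LinkSum.isKauffmanPolynomial_braidingD ht (hz h) hn⟩
  have hI₀ : I ≠ 0 := by
    rintro rfl
    simp at hI
  exact LinkSum.isKauffmanPolynomial_braidingC hI₀ ht (LinkSum.sub_inv_ne_zero hs h) hn
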